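/- **Notation.** Let $d\ge 1$, let $M$ be a $d\times d$ real invertible matrix, and let $f_{U;k}(x):=|\det U|^{1/2}f(Ux-k)$ for an invertible matrix $U$, $f\in L_2(\mathbb R^d)$ and $k\in\mathbb Z^d$. For finite lists $\Phi=\{\phi^1,\dots,\phi^r\}$, $\Psi=\{\psi^1,\dots,\psi^s\}$ in $L_2(\mathbb R^d)$ (repetitions allowed, $r,s\in\mathbb N\cup\{0\}$) and $J\in\mathbb Z$ put $$\mathrm{WS}_J(\Phi;\Psi):=\{\phi^\ell_{M^J;k}\}_{1\le\ell\le r,\;k\in\mathbb Z^d}\cup\{\psi^n_{M^j;k}\}_{j\ge J,\;1\le n\le s,\;k\in\mathbb Z^d},\qquad \mathrm{WS}(\Psi):=\{\psi^n_{M^j;k}\}_{j\in\mathbb Z,\;1\le n\le s,\;k\in\mathbb Z^d},$$ regarded as families (with multiplicity). A family $(e_i)_{i\in I}$ in $L_2(\mathbb R^d)$ is a Riesz basis if its linear span is dense and there are constants $C_1,C_2>0$ with $C_1\sum|c_i|^2\le\|\sum c_ie_i\|^2\le C_2\sum|c_i|^2$ for all finitely supported $(c_i)$. Two families $(e_i)_{i\in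 I}$, $(\tilde e_i)_{i\in I}$ form a pair of biorthogonal bases if each is a Riesz basis and $\langle e_i,\tilde e_{i'}\rangle=\delta_{i,i'}$ for all $i,i'\in I$. The pairs $(\mathrm{WS}_J(\Phi;\Psi),\mathrm{WS}_J(\tilde\Phi;\tilde\Psi))$ and $(\mathrm{WS}(\Psi),\mathrm{WS}(\tilde\Psi))$ are called a pair of nonhomogeneous, respectively homogeneous, biorthogonal $M$-wavelet bases if they are pairs of biorthogonal bases for the above indexings. The Fourier transform extends $\hat f(\xi)=\int f(x)e^{-ix\cdot\xi}\,dx$ to $L_2(\mathbb R^d)$; write $\phi=[\phi^1,\dots,\phi^r]^T$, $\psi=[\psi^1,\dots,\psi^s]^T$, and similarly $\tilde\phi,\tilde\psi$. $L_2(\mathbb T^d)$ denotes the $2\pi\mathbb Z^d$-periodic measurable functions that are square integrable on $[-\pi,\pi)^d$. $M$ is expansive if all its complex eigenvalues have modulus greater than one. **Theorem.** (A) Let $\Phi=\{\phi^1,\dots,\phi^r\}$, $\Psi=\{\psi^1,\dots,\psi^s\}$, $\tilde\Phi=\{\tilde\phi^1,\dots,\tilde\phi^r\}$, $\tilde\Psi=\{\tilde\psi^1,\dots,\tilde\psi^s\}$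 be finite lists in $L_2(\mathbb R^d)$ such that $(\mathrm{WS}_J(\Phi;\Psi),\mathrm{WS}_J(\tilde\Phi;\tilde\Psi))$ is a pair of nonhomogeneous biorthogonal $M$-wavelet bases for some integer $J$. Then: 1. it is such a pair for every integer $J$; 2. there exist $r\times r$ matrices $a_k,\tilde a_k$ and $s\times r$ matrices $b_k,\tilde b_k$, $k\in\mathbb Z^d$, with entries in $L_2(\mathbb T^d)$, such that for all $k\in\mathbb Z^d$ and a.e. $\xi\in\mathbb R^d$ $$e^{-ik\cdot M^T\xi}\hat\phi(M^T\xi)=a_k(\xi)\hat\phi(\xi),\quad e^{-ik\cdot M^T\xi}\hat\psi(M^T\xi)=b_k(\xi)\hat\phi(\xi),$$ $$e^{-ik\cdot M^T\xi}\hat{\tilde\phi}(M^T\xi)=\tilde a_k(\xi)\hat{\tilde\phi}(\xi),\quad e^{-ik\cdot M^T\xi}\hat{\tilde\psi}(M^T\xi)=\tilde b_k(\xi)\hat{\tilde\phi}(\xi),$$ and such that moreover, if $M$ is an integer matrix and $m:=|\det M|$, then $s=r(m-1)$, the set $[(M^T)^{-1}\mathbb Z^d]\cap[0,1)^d=\{\omega_0,\dots,\omega_{m-1}\}$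 has exactly $m$ elements, and $$\overline{P_{[\tilde a_0,\tilde b_0]}(\xi)}^{T}P_{[a_0,b_0]}(\xi)=I_{rm}\quad\text{for a.e. }\xi\in\mathbb R^d,$$ where $$P_{[a,b]}(\xi):=\begin{bmatrix}a(\xi+2\pi\omega_0)&\cdots&a(\xi+2\pi\omega_{m-1})\\ b(\xi+2\pi\omega_0)&\cdots&b(\xi+2\pi\omega_{m-1})\end{bmatrix};$$ 3. if $M$ is expansive, then $(\mathrm{WS}(\Psi),\mathrm{WS}(\tilde\Psi))$ is a pair of homogeneous biorthogonal $M$-wavelet bases in $L_2(\mathbb R^d)$. (B) Let $\Phi=\{\phi^1,\dots,\phi^r\}$ and $\Psi=\{\psi^1,\dots,\psi^s\}$ be finite lists in $L_2(\mathbb R^d)$ such that $\mathrm{WS}_J(\Phi;\Psi)$ is an orthonormal basis of $L_2(\mathbb R^d)$ for some integer $J$. Then $s=r(|\det M|-1)$ if $M$ is an integer matrix; there exist an $r\times r$ matrix $a$ and an $s\times r$ matrix $b$ with entries in $L_2(\mathbb T^d)$ such that $\hat\phi(M^T\xi)=a(\xi)\hat\phi(\xi)$ and $\hat\psi(M^T\xi)=b(\xi)\hat\phi(\xi)$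 for a.e. $\xi\in\mathbb R^d$; and if $M$ is expansive, then $\mathrm{WS}(\Psi)$ is an orthonormal basis of $L_2(\mathbb R^d)$. -/

import Mathlib

open MeasureTheory Matrix
open scoped ENNReal FourierTransform

noncomputable section

namespace WaveletSystems

/-- The Euclidean space `ℝ^d`. -/
abbrev E (d : ℕ) : Type := EuclideanSpace ℝ (Fin d)

/-- The complex Hilbert space `L²(ℝ^d)`, with respect to Lebesgue measure. -/
abbrev L2 (d : ℕ) : Type := Lp ℂ 2 (volume : Measure (E d))

/-- The integer point `k ∈ ℤ^d`, seen as a vector of `ℝ^d`. -/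
def latticePt {d : ℕ} (k : Fin d → ℤ) : E d := WithLp.toLp 2 (fun i => (k i : ℝ))

/-- Matrix times vector, `U x`. -/
def act {d : ℕ} (U : Matrix (Fin d) (Fin d) ℝ) (x : E d) : E d :=
  WithLp.toLp 2 (U *ᵥ x.ofLp)

/-- The function `f_{U;k}(x) = |det U|^{1/2} f(U x - k)`. -/
def dilFun {d : ℕ} (U : GL (Fin d) ℝ) (k : E d) (f : E d → ℂ) (x : E d) : ℂ :=
  (Real.sqrt |(U : Matrix (Fin d) (Fin d) ℝ).det| : ℂ) * f (act U x - k)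

theorem memLp_dilFun {d : ℕ} (U : GL (Fin d) ℝ) (k : E d) (f : L2 d) :
    MemLp (dilFun U k f) 2 (volume : Measure (E d)) := by
  have hdet : LinearMap.det (Matrix.toLpLin 2 2 (U : Matrix (Fin d) (Fin d) ℝ)) ≠ 0 := by
    rw [Matrix.toLpLin_eq_toLin, LinearMap.det_toLin]
    exact ((Matrix.isUnit_iff_isUnit_det _).1 U.isUnit).ne_zero
  have hmeas : Measurable (Matrix.toLpLin 2 2 (U : Matrix (Fin d) (Fin d) ℝ)) :=
    (LinearMap.continuous_of_finiteDimensional _).measurable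
  have hmap := Measure.map_linearMap_addHaar_eq_smul_addHaar (volume : Measure (E d)) hdet
  have h1 : MemLp (fun y : E d => f (y - k)) 2 (volume : Measure (E d)) :=
    (Lp.memLp f).comp_measurePreserving (measurePreserving_sub_right _ k)
  have h2 : MemLp (fun y : E d => f (y - k)) 2
      (Measure.map (Matrix.toLpLin 2 2 (U : Matrix (Fin d) (Fin d) ℝ)) volume) := by
    rw [hmap]
    exact h1.smul_measure ENNReal.ofReal_ne_top
  exact (h2.comp_of_map hmeas.aemeasurable).const_mul _

/-- The element `f_{U;k}` of `L²(ℝ^d)`. -/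
def dil {d : ℕ} (U : GL (Fin d) ℝ) (k : Fin d → ℤ) (f : L2 d) : L2 d :=
  (memLp_dilFun U (latticePt k) f).toLp _

/-- Index set of the nonhomogeneous wavelet system at coarsest level `J`, with `r` generators
at level `J` and `s` wavelet generators at all levels `j ≥ J`. -/
abbrev NWIndex (d r s : ℕ) (J : ℤ) : Type :=
  (Fin r × (Fin d → ℤ)) ⊕ (Fin s × {j : ℤ // J ≤ j} × (Fin d → ℤ))

/-- The nonhomogeneous wavelet system `WS_J(Φ; Ψ)`, as a family (with multiplicity):
`φ^ℓ_{M^J;k}`, and `ψ^n_{M^j;k}` for `j ≥ J`. -/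
def nonhomWS {d r s : ℕ} (M : GL (Fin d) ℝ) (φ : Fin r → L2 d) (ψ : Fin s → L2 d) (J : ℤ) :
    NWIndex d r s J → L2 d :=
  Sum.elim (fun p => dil (M ^ J) p.2 (φ p.1)) (fun p => dil (M ^ (p.2.1 : ℤ)) p.2.2 (ψ p.1))

/-- The homogeneous wavelet system `WS(Ψ)`, as a family: `ψ^n_{M^j;k}` for all `j ∈ ℤ`. -/
def homWS {d s : ℕ} (M : GL (Fin d) ℝ) (ψ : Fin s → L2 d) :
    Fin s × ℤ × (Fin d → ℤ) → L2 d :=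
  fun p => dil (M ^ p.2.1) p.2.2 (ψ p.1)

/-- The linear span of the family is dense. -/
def SpanDense {d : ℕ} {ι : Type} (e : ι → L2 d) : Prop :=
  Dense (Submodule.span ℂ (Set.range e) : Set (L2 d))

/-- Riesz basis of `L²(ℝ^d)`: dense linear span, and two-sided norm bounds for all finitely
supported coefficient sequences. -/
def IsRieszBasis {d : ℕ} {ι : Type} (e : ι → L2 d) : Prop :=
  SpanDense e ∧
  ∃ C₁ C₂ : ℝ, 0 < C₁ ∧ 0 < C₂ ∧ ∀ c : ι →₀ ℂ,
    C₁ * ∑ i ∈ c.support, ‖c i‖ ^ 2 ≤ ‖∑ i ∈ c.support, c i • e i‖ ^ 2 ∧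
    ‖∑ i ∈ c.support, c i • e i‖ ^ 2 ≤ C₂ * ∑ i ∈ c.support, ‖c i‖ ^ 2

open Classical in
/-- Pair of biorthogonal Riesz bases of `L²(ℝ^d)`. (Mathlib's inner product is conjugate-linear
in its first argument, so `inner ℂ g f = ∫ f · conj g`.) -/
def IsBiorthogonalPair {d : ℕ} {ι : Type} (e e' : ι → L2 d) : Prop :=
  IsRieszBasis e ∧ IsRieszBasis e' ∧
  ∀ i i' : ι, inner ℂ (e' i') (e i) = if i = i' then (1 : ℂ) else 0

/-- Orthonormal basis of `L²(ℝ^d)`. -/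
def IsONB {d : ℕ} {ι : Type} (e : ι → L2 d) : Prop :=
  Orthonormal ℂ e ∧ SpanDense e

/-- The Fourier transform normalised by `f̂(ξ) = ∫ f(x) e^{-i x·ξ} dx` on `L¹ ∩ L²`. Mathlib's
`𝓕` on `L²` has the kernel `e^{-2π i x·ξ}`, whence the change of variable. -/
def hat {d : ℕ} (f : L2 d) (ξ : E d) : ℂ :=
  (𝓕 f : L2 d) ((2 * Real.pi)⁻¹ • ξ)

/-- `2πℤ^d`-periodic measurable functions that are square integrable over a period cell. -/
def IsPeriodicL2 {d : ℕ} (a : E d → ℂ) : Prop :=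
  Measurable a ∧
  (∀ (ξ : E d) (k : Fin d → ℤ), a (ξ + (2 * Real.pi) • latticePt k) = a ξ) ∧
  MemLp a 2 (volume.restrict {ξ : E d | ∀ i, ξ i ∈ Set.Ico (-Real.pi) Real.pi})

/-- All entries of the matrix-valued function are in `L²` of the torus. -/
def IsPeriodicL2Matrix {d m n : ℕ} (A : E d → Matrix (Fin m) (Fin n) ℂ) : Prop :=
  ∀ i j, IsPeriodicL2 (fun ξ => A ξ i j)

/-- The refinement equation `e^{-i k·Mᵀξ} η̂(Mᵀξ) = A(ξ) φ̂(ξ)` for a.e. `ξ`, where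
`η`, `φ` are column vectors of functions. -/
def Refines {d m r : ℕ} (M : GL (Fin d) ℝ) (k : Fin d → ℤ) (A : E d → Matrix (Fin m) (Fin r) ℂ)
    (η : Fin m → L2 d) (φ : Fin r → L2 d) : Prop :=
  ∀ᵐ ξ : E d,
    Complex.exp (-Complex.I * ((latticePt k ⬝ᵥ act (M : Matrix (Fin d) (Fin d) ℝ)ᵀ ξ : ℝ) : ℂ)) •
        (fun i => hat (η i) (act (M : Matrix (Fin d) (Fin d) ℝ)ᵀ ξ)) =
      A ξ *ᵥ (fun j => hat (φ j) ξ)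

/-- All (complex) eigenvalues have modulus greater than one. -/
def IsExpansive {d : ℕ} (M : GL (Fin d) ℝ) : Prop :=
  ∀ z ∈ spectrum ℂ ((M : Matrix (Fin d) (Fin d) ℝ).map (algebraMap ℝ ℂ)), 1 < ‖z‖

/-- The set `[(Mᵀ)⁻¹ ℤ^d] ∩ [0,1)^d`. -/
def freqShifts {d : ℕ} (M : GL (Fin d) ℝ) : Set (E d) :=
  {ω | (∀ i, ω i ∈ Set.Ico (0 : ℝ) 1) ∧
    ∃ k : Fin d → ℤ, ω = act ((M : Matrix (Fin d) (Fin d) ℝ)ᵀ)⁻¹ (latticePt k)}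

/-- The block matrix with rows `[a(ξ + 2πω)]_ω` and `[b(ξ + 2πω)]_ω`, where `ω` runs over
`freqShifts M`. -/
def polyMatrix {d r s : ℕ} (M : GL (Fin d) ℝ) (a : E d → Matrix (Fin r) (Fin r) ℂ)
    (b : E d → Matrix (Fin s) (Fin r) ℂ) (ξ : E d) :
    Matrix (Fin r ⊕ Fin s) (freqShifts M × Fin r) ℂ :=
  Matrix.of fun i p => Matrix.fromRows (a (ξ + (2 * Real.pi) • (p.1 : E d)))
    (b (ξ + (2 * Real.pi) • (p.1 : E d))) i p.2

open Classical in
/-- `P_{[ã,b̃]}(ξ)^* P_{[a,b]}(ξ) = I` for a.e. `ξ`. -/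
def IsDualFilterBank {d r s : ℕ} (M : GL (Fin d) ℝ)
    (a' : E d → Matrix (Fin r) (Fin r) ℂ) (b' : E d → Matrix (Fin s) (Fin r) ℂ)
    (a : E d → Matrix (Fin r) (Fin r) ℂ) (b : E d → Matrix (Fin s) (Fin r) ℂ) : Prop :=
  ∀ᵐ ξ : E d, (polyMatrix M a' b' ξ)ᴴ * polyMatrix M a b ξ = 1

end WaveletSystems

end

/-!
# Biorthogonal wavelet bases

Write `T_k` for integer translations and `D` for the unitary dilation `f ↦ f_{M;0}`. The system of
level `J + 1` is the image under `D` of the system of level `J`, so that the level is irrelevant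
(`isBiorthogonalPair_nonhomWS_of_level`), and everything below compares the systems of levels `0`
and `1`. The main tool is the expansion `f = ∑ ⟨f, e'_i⟩ e_i` in a pair of biorthogonal bases `e`,
`e'` (`IsBiorthogonalPair.hasSum`), whose coefficients are square summable with a sum comparable to
`‖f‖²`.

*Refinement.* The systems of levels `0` and `1` have the wavelets of level at least `1` in common.
A generator `φ^ℓ(· - k)` or `ψ^n(· - k)` is orthogonal to the dual wavelets of level at least `1`,
by biorthogonality at level `0`; hence its expansion in the system of level `1` involves the
`φ_{M;k}` only (`hasSum_maskCoeff`). The Fourier transform turns this `ℓ²` combination into a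
product with a square integrable periodic function (`hat_of_hasSum`), which is the refinement
equation (`hat_act_transpose_eq_sum_mask`).

*Filter bank.* Let `M` be an integer matrix. Biorthogonality of the generators says that certain
correlations of the coefficient sequences along `M ℤ^d` are Kronecker deltas. These are the
Fourier coefficients with index in `M ℤ^d` of products of masks, and summing over the frequency
shifts keeps exactly those (`sum_range_freqPt_eq`), so `P P'^* = 1` by uniqueness of Fourier
coefficients of integrable functions (`sum_mask_mul_conj`). The matrices are square: the sum over
all generators, all `ℓ` and all `k` of the products of dual coefficients is `r + s` when summed
generator by generator, and `r |det M|` when `k` is grouped modulo `M ℤ^d` (`card_generators`).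
Thus `P'^* P = 1`.

*Homogeneous systems.* Biorthogonality and the Riesz bounds concern finitely many elements, which
up to a dilation lie in the system of level `0`. For density, let `f` be orthogonal to all
`ψ_{M^j;k}`. For each `n`, the norm of `f`, that is of `D^n f`, is controlled by the inner
products of `D^n f` with the `T_k φ^ℓ`, since `D^n f` is orthogonal to the wavelets as well. Let `g`
have bounded support. When `M` is expansive, the support of `D^n g` shrinks to the origin, so that
the inner products of `D^n g` with the `T_k φ^ℓ` only see `φ^ℓ` near `ℤ^d`, a null set, and are
small for some `n` (`eventually_sum_inner_translate_le`). Approximating `f` by such `g`, with the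
error controlled by the Bessel bound uniformly in `n`, gives `f = 0`
(`eq_zero_of_forall_inner_homWS_eq_zero`).
-/

noncomputable section

namespace WaveletSystems

/-! ### Biorthogonal Riesz bases -/

variable {d : ℕ} {ι κ : Type} {e e' : ι → L2 d}

/-- The Riesz bounds, for coefficients on an arbitrary finite set of indices. -/
theorem IsRieszBasis.exists_bounds (h : IsRieszBasis e) :
    ∃ C₁ C₂ : ℝ, 0 < C₁ ∧ 0 < C₂ ∧ ∀ (S : Finset ι) (c : ι → ℂ),
      C₁ * ∑ i ∈ S, ‖c i‖ ^ 2 ≤ ‖∑ i ∈ S, c i • e i‖ ^ 2 ∧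
      ‖∑ i ∈ S, c i • e i‖ ^ 2 ≤ C₂ * ∑ i ∈ S, ‖c i‖ ^ 2 := by
  classical
  obtain ⟨-, C₁, C₂, h₁, h₂, hb⟩ := h
  refine ⟨C₁, C₂, h₁, h₂, fun S c => ?_⟩
  let a : ι →₀ ℂ := Finsupp.indicator S (fun i _ => c i)
  have hS : a.support ⊆ S := Finsupp.support_indicator_subset _ _
  have ha : ∀ i ∈ S, a i = c i := fun i hi => Finsupp.indicator_of_mem hi _
  have e₁ : ∑ i ∈ a.support, ‖a i‖ ^ 2 = ∑ i ∈ S, ‖c i‖ ^ 2 := by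
    rw [Finset.sum_subset hS (fun i _ hi => by simp [Finsupp.notMem_support_iff.1 hi])]
    exact Finset.sum_congr rfl fun i hi => by rw [ha i hi]
  have e₂ : ∑ i ∈ a.support, a i • e i = ∑ i ∈ S, c i • e i := by
    rw [Finset.sum_subset hS (fun i _ hi => by rw [Finsupp.notMem_support_iff.1 hi, zero_smul])]
    exact Finset.sum_congr rfl fun i hi => by rw [ha i hi]
  have := hb a
  rwa [e₁, e₂] at this

theorem IsBiorthogonalPair.symm (h : IsBiorthogonalPair e e') : IsBiorthogonalPair e' e := by
  refine ⟨h.2.1, h.1, fun i i' => ?_⟩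
  rw [← inner_conj_symm, h.2.2 i' i]
  by_cases hii : i = i'
  · simp [hii]
  · simp [hii, Ne.symm hii]

/-- A Bessel bound, uniform over finite sets of indices, for the coefficients of `f` with respect
to the dual family. It holds on the dense span by the lower Riesz bound. -/
theorem IsBiorthogonalPair.exists_bessel (h : IsBiorthogonalPair e e') :
    ∃ C : ℝ, 0 < C ∧ ∀ (f : L2 d) (S : Finset ι),
      ∑ i ∈ S, ‖inner ℂ (e' i) f‖ ^ 2 ≤ C * ‖f‖ ^ 2 := by
  classical
  obtain ⟨C₁, C₂, h₁, h₂, hb⟩ := h.1.exists_bounds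
  refine ⟨C₁⁻¹, inv_pos.2 h₁, fun f S => ?_⟩
  refine h.1.1.induction (P := fun f => ∑ i ∈ S, ‖inner ℂ (e' i) f‖ ^ 2 ≤ C₁⁻¹ * ‖f‖ ^ 2)
    ?_ ?_ f
  · intro g hg
    obtain ⟨c, rfl⟩ := Finsupp.mem_span_range_iff_exists_finsupp.1 hg
    have hc : ∀ i, inner ℂ (e' i) (c.sum fun i a => a • e i) = c i := by
      intro i
      simp only [Finsupp.sum, inner_sum, inner_smul_right, h.2.2]
      simp +contextual [eq_comm]
    simp only [hc]
    have hle : ∑ i ∈ S, ‖c i‖ ^ 2 ≤ ∑ i ∈ c.support, ‖c i‖ ^ 2 := by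
      have h1 : ∑ i ∈ S, ‖c i‖ ^ 2 = ∑ i ∈ S ∩ c.support, ‖c i‖ ^ 2 := by
        refine (Finset.sum_subset Finset.inter_subset_left fun i hi hi' => ?_).symm
        have : c i = 0 := by
          by_contra hne
          exact hi' (Finset.mem_inter.2 ⟨hi, Finsupp.mem_support_iff.2 hne⟩)
        simp [this]
      rw [h1]
      exact Finset.sum_le_sum_of_subset_of_nonneg Finset.inter_subset_right
        fun _ _ _ => by positivity
    refine hle.trans ?_
    rw [inv_mul_eq_div, le_div_iff₀ h₁, mul_comm]
    exact (hb c.support c).1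
  · exact isClosed_le (by fun_prop) (by fun_prop)

theorem IsBiorthogonalPair.summable_sq (h : IsBiorthogonalPair e e') (f : L2 d) :
    Summable fun i => ‖inner ℂ (e' i) f‖ ^ 2 := by
  obtain ⟨C, -, hC⟩ := h.exists_bessel
  exact summable_of_sum_le (fun _ => by positivity) (hC f)

/-- The expansion of a vector in a Riesz basis, with coefficients given by the dual basis: the
partial sums are uniformly bounded operators, and the expansion is finite on a dense subspace. -/
theorem IsBiorthogonalPair.hasSum (h : IsBiorthogonalPair e e') (f : L2 d) :
    HasSum (fun i => inner ℂ (e' i) f • e i) f := by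
  classical
  obtain ⟨C₁, C₂, h₁, h₂, hb⟩ := h.1.exists_bounds
  obtain ⟨C, hC0, hC⟩ := h.exists_bessel
  have hbd : ∀ (g : L2 d) (S : Finset ι),
      ‖∑ i ∈ S, inner ℂ (e' i) g • e i‖ ≤ Real.sqrt (C₂ * C) * ‖g‖ := by
    intro g S
    refine (Real.le_sqrt (norm_nonneg _) (by positivity)).2 (((hb S _).2).trans
      (mul_le_mul_of_nonneg_left (hC g S) h₂.le)) |>.trans (le_of_eq ?_)
    rw [← mul_assoc, Real.sqrt_mul (by positivity), Real.sqrt_sq (norm_nonneg _)]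
  rw [HasSum, SummationFilter.unconditional_filter, Metric.tendsto_atTop]
  intro ε hε
  set K := Real.sqrt (C₂ * C) with hK
  have hK0 : 0 ≤ K := Real.sqrt_nonneg _
  obtain ⟨g, hg, hfg⟩ := h.1.1.exists_dist_lt f (ε := ε / (K + 1)) (by positivity)
  obtain ⟨c, rfl⟩ := Finsupp.mem_span_range_iff_exists_finsupp.1 hg
  have hc : ∀ i, inner ℂ (e' i) (c.sum fun i a => a • e i) = c i := by
    intro i
    simp only [Finsupp.sum, inner_sum, inner_smul_right, h.2.2]
    simp +contextual [eq_comm]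
  refine ⟨c.support, fun S hS => ?_⟩
  set g := c.sum fun i a => a • e i
  have hsum : ∑ i ∈ S, inner ℂ (e' i) g • e i = g := by
    simp only [hc]
    refine (Finset.sum_subset hS fun i _ hi => ?_).symm
    rw [Finsupp.notMem_support_iff.1 hi, zero_smul]
  have hsub : ∑ i ∈ S, inner ℂ (e' i) f • e i - f
      = ∑ i ∈ S, inner ℂ (e' i) (f - g) • e i - (f - g) := by
    simp only [inner_sub_right, sub_smul, Finset.sum_sub_distrib, hsum]
    abel
  rw [dist_eq_norm] at hfg ⊢
  rw [hsub]
  calc _ ≤ K * ‖f - g‖ + ‖f - g‖ := (norm_sub_le _ _).trans (by gcongr; exact hbd _ _)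
    _ = (K + 1) * ‖f - g‖ := by ring
    _ < (K + 1) * (ε / (K + 1)) := by gcongr
    _ = ε := by field_simp

/-- Parseval's identity for a pair of biorthogonal bases. -/
theorem IsBiorthogonalPair.hasSum_inner (h : IsBiorthogonalPair e e') (f g : L2 d) :
    HasSum (fun i => inner ℂ g (e i) * inner ℂ (e' i) f) (inner ℂ g f) := by
  have := (h.hasSum f).mapL (innerSL ℂ g)
  simpa [inner_smul_right, mul_comm] using this

/-- A vector is controlled by its coefficients. -/
theorem IsBiorthogonalPair.exists_norm_le (h : IsBiorthogonalPair e e') :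
    ∃ C : ℝ, 0 < C ∧ ∀ f : L2 d, ‖f‖ ^ 2 ≤ C * ∑' i, ‖inner ℂ (e' i) f‖ ^ 2 := by
  obtain ⟨C₁, C₂, h₁, h₂, hb⟩ := h.1.exists_bounds
  refine ⟨C₂, h₂, fun f => ?_⟩
  have ht : Filter.Tendsto (fun S : Finset ι => ‖∑ i ∈ S, inner ℂ (e' i) f • e i‖ ^ 2)
      Filter.atTop (nhds (‖f‖ ^ 2)) := by
    have := (h.hasSum f)
    rw [HasSum, SummationFilter.unconditional_filter] at this
    exact (this.norm).pow 2
  refine le_of_tendsto ht (Filter.Eventually.of_forall fun S => ((hb S _).2).trans ?_)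
  exact mul_le_mul_of_nonneg_left ((h.summable_sq f).sum_le_tsum S fun _ _ => by positivity) h₂.le

theorem IsRieszBasis.map (h : IsRieszBasis e) (D : L2 d ≃ₗᵢ[ℂ] L2 d) :
    IsRieszBasis (fun i => D (e i)) := by
  obtain ⟨hd, C₁, C₂, h₁, h₂, hb⟩ := h
  refine ⟨?_, C₁, C₂, h₁, h₂, fun c => ?_⟩
  · have h3 : (Submodule.span ℂ (Set.range fun i => D (e i)) : Set (L2 d))
        = D '' (Submodule.span ℂ (Set.range e) : Set (L2 d)) := by
      have : Set.range (fun i => D (e i)) = D.toLinearEquiv.toLinearMap '' Set.range e := by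
        rw [← Set.range_comp]; rfl
      rw [this, Submodule.span_image]
      rfl
    rw [SpanDense, h3]
    exact D.surjective.denseRange.dense_image D.continuous hd
  · have : ∑ i ∈ c.support, c i • D (e i) = D (∑ i ∈ c.support, c i • e i) := by
      simp [map_sum]
    rw [this, D.norm_map]
    exact hb c

theorem IsBiorthogonalPair.map (h : IsBiorthogonalPair e e') (D : L2 d ≃ₗᵢ[ℂ] L2 d) :
    IsBiorthogonalPair (fun i => D (e i)) (fun i => D (e' i)) :=
  ⟨h.1.map D, h.2.1.map D, fun i i' => by rw [D.inner_map_map]; exact h.2.2 i i'⟩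

theorem IsRieszBasis.comp_equiv (h : IsRieszBasis e) (σ : κ ≃ ι) :
    IsRieszBasis (fun i => e (σ i)) := by
  classical
  obtain ⟨C₁, C₂, h₁, h₂, hb⟩ := h.exists_bounds
  refine ⟨?_, C₁, C₂, h₁, h₂, fun c => ?_⟩
  · have : Set.range (fun i => e (σ i)) = Set.range e := σ.surjective.range_comp e
    rw [SpanDense, this]
    exact h.1
  · have := hb (c.support.map σ.toEmbedding) (fun i => c (σ.symm i))
    simpa [Finset.sum_map] using this

theorem IsBiorthogonalPair.comp_equiv (h : IsBiorthogonalPair e e') (σ : κ ≃ ι) :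
    IsBiorthogonalPair (fun i => e (σ i)) (fun i => e' (σ i)) :=
  ⟨h.1.comp_equiv σ, h.2.1.comp_equiv σ, fun i i' => by
    rw [h.2.2]
    by_cases hii : i = i' <;> simp [hii]⟩

theorem IsONB.isBiorthogonalPair (h : IsONB e) : IsBiorthogonalPair e e := by
  classical
  have hR : IsRieszBasis e := by
    refine ⟨h.2, 1, 1, one_pos, one_pos, fun c => ?_⟩
    have : ‖∑ i ∈ c.support, c i • e i‖ ^ 2 = ∑ i ∈ c.support, ‖c i‖ ^ 2 := by
      rw [← inner_self_eq_norm_sq (𝕜 := ℂ), h.1.inner_sum c c c.support, map_sum]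
      refine Finset.sum_congr rfl fun i _ => ?_
      rw [RCLike.conj_mul]
      norm_cast
    rw [this]
    simp
  refine ⟨hR, hR, fun i i' => ?_⟩
  rw [orthonormal_iff_ite.1 h.1]
  by_cases hii : i = i' <;> simp [hii, eq_comm]

theorem IsBiorthogonalPair.isONB (h : IsBiorthogonalPair e e) : IsONB e := by
  classical
  refine ⟨orthonormal_iff_ite.2 fun i i' => ?_, h.1.1⟩
  rw [h.2.2]
  by_cases hii : i = i' <;> simp [hii, eq_comm]

/-! ### Dilations and integer translations -/

theorem act_eq_toLpLin (U : Matrix (Fin d) (Fin d) ℝ) (x : E d) :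
    act U x = Matrix.toLpLin 2 2 U x := rfl

theorem act_add (U : Matrix (Fin d) (Fin d) ℝ) (x y : E d) : act U (x + y) = act U x + act U y := by
  simp [act_eq_toLpLin]

theorem act_sub (U : Matrix (Fin d) (Fin d) ℝ) (x y : E d) : act U (x - y) = act U x - act U y := by
  simp [act_eq_toLpLin]

theorem act_smul (U : Matrix (Fin d) (Fin d) ℝ) (c : ℝ) (x : E d) :
    act U (c • x) = c • act U x := by
  simp [act_eq_toLpLin]

@[simp] theorem act_zero (U : Matrix (Fin d) (Fin d) ℝ) : act U 0 = 0 := by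
  simp [act_eq_toLpLin]

theorem act_mul (U V : Matrix (Fin d) (Fin d) ℝ) (x : E d) : act (U * V) x = act U (act V x) := by
  simp [act, Matrix.mulVec_mulVec]

@[simp] theorem act_one (x : E d) : act (1 : Matrix (Fin d) (Fin d) ℝ) x = x := by
  simp [act]

@[simp] theorem latticePt_zero : latticePt (0 : Fin d → ℤ) = 0 := by
  ext i; simp [latticePt]

theorem latticePt_add (k l : Fin d → ℤ) : latticePt (k + l) = latticePt k + latticePt l := by
  ext i; simp [latticePt]

theorem latticePt_injective : Function.Injective (latticePt (d := d)) := by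
  intro k l h
  ext i
  have := congrArg (fun v : E d => v i) h
  simpa [latticePt] using this

theorem latticePt_mulVec (N : Matrix (Fin d) (Fin d) ℤ) (k : Fin d → ℤ) :
    latticePt (N *ᵥ k) = act (N.map (Int.cast : ℤ → ℝ)) (latticePt k) := by
  ext i
  simp [latticePt, act, Matrix.mulVec, dotProduct]

theorem continuous_act (U : Matrix (Fin d) (Fin d) ℝ) : Continuous (act U) :=
  (Matrix.toLpLin 2 2 U).continuous_of_finiteDimensional

theorem det_ne_zero (U : GL (Fin d) ℝ) : (U : Matrix (Fin d) (Fin d) ℝ).det ≠ 0 :=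
  ((Matrix.isUnit_iff_isUnit_det _).1 U.isUnit).ne_zero

theorem map_act_volume {U : Matrix (Fin d) (Fin d) ℝ} (hU : U.det ≠ 0) :
    Measure.map (act U) (volume : Measure (E d)) = ENNReal.ofReal |U.det⁻¹| • volume := by
  have hdet : LinearMap.det (Matrix.toLpLin 2 2 U) = U.det := by
    rw [Matrix.toLpLin_eq_toLin, LinearMap.det_toLin]
  have := Measure.map_linearMap_addHaar_eq_smul_addHaar (volume : Measure (E d))
    (f := Matrix.toLpLin 2 2 U) (by rwa [hdet])
  rwa [hdet] at this

theorem quasiMeasurePreserving_act {U : Matrix (Fin d) (Fin d) ℝ} (hU : U.det ≠ 0) :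
    Measure.QuasiMeasurePreserving (act U) (volume : Measure (E d)) volume :=
  ⟨(continuous_act U).measurable, by
    rw [map_act_volume hU]; exact Measure.smul_absolutelyContinuous⟩

theorem quasiMeasurePreserving_act_sub {U : Matrix (Fin d) (Fin d) ℝ} (hU : U.det ≠ 0) (k : E d) :
    Measure.QuasiMeasurePreserving (fun x => act U x - k) (volume : Measure (E d)) volume :=
  (measurePreserving_sub_right volume k).quasiMeasurePreserving.comp
    (quasiMeasurePreserving_act hU)

theorem dil_coeFn (U : GL (Fin d) ℝ) (k : Fin d → ℤ) (f : L2 d) :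
    dil U k f =ᵐ[volume] dilFun U (latticePt k) f :=
  MemLp.coeFn_toLp _

theorem dil_add (U : GL (Fin d) ℝ) (k : Fin d → ℤ) (f g : L2 d) :
    dil U k (f + g) = dil U k f + dil U k g := by
  apply Lp.ext
  filter_upwards [dil_coeFn U k (f + g), dil_coeFn U k f, dil_coeFn U k g,
    Lp.coeFn_add (dil U k f) (dil U k g),
    (quasiMeasurePreserving_act_sub (det_ne_zero U) (latticePt k)).ae (Lp.coeFn_add f g)]
    with x h₁ h₂ h₃ h₄ h₅
  rw [h₁, h₄, Pi.add_apply, h₂, h₃, dilFun, h₅]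
  simp [dilFun, mul_add]

theorem dil_smul (U : GL (Fin d) ℝ) (k : Fin d → ℤ) (c : ℂ) (f : L2 d) :
    dil U k (c • f) = c • dil U k f := by
  apply Lp.ext
  filter_upwards [dil_coeFn U k (c • f), dil_coeFn U k f,
    Lp.coeFn_smul c (dil U k f),
    (quasiMeasurePreserving_act_sub (det_ne_zero U) (latticePt k)).ae (Lp.coeFn_smul c f)]
    with x h₁ h₂ h₃ h₄
  rw [h₁, h₃, Pi.smul_apply, h₂, dilFun, h₄]
  simp [dilFun, mul_left_comm]

/-- Composition of two dilations with translation. -/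
theorem dil_dil (U V : GL (Fin d) ℝ) (j k m : Fin d → ℤ)
    (hm : latticePt m = latticePt k + act U (latticePt j)) (f : L2 d) :
    dil V j (dil U k f) = dil (U * V) m f := by
  apply Lp.ext
  filter_upwards [dil_coeFn V j (dil U k f), dil_coeFn (U * V) m f,
    (quasiMeasurePreserving_act_sub (det_ne_zero V) (latticePt j)).ae (dil_coeFn U k f)]
    with x h₁ h₂ h₃
  rw [h₁, h₂, dilFun, h₃, dilFun, dilFun, ← mul_assoc, hm]
  congr 1
  · rw [Units.val_mul, Matrix.det_mul, abs_mul, Real.sqrt_mul (abs_nonneg _), mul_comm]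
    push_cast; rfl
  · rw [Units.val_mul, act_mul, act_sub]
    congr 1
    abel

theorem dil_one_zero (f : L2 d) : dil 1 0 f = f := by
  apply Lp.ext
  filter_upwards [dil_coeFn 1 0 f] with x h
  rw [h]
  simp [dilFun]

theorem norm_dil (U : GL (Fin d) ℝ) (k : Fin d → ℤ) (f : L2 d) : ‖dil U k f‖ = ‖f‖ := by
  have hU := det_ne_zero U
  have hsub := measurePreserving_sub_right (volume : Measure (E d)) (latticePt k)
  have key : eLpNorm (dilFun U (latticePt k) f) 2 volume = eLpNorm f 2 volume := by
    have h1 : dilFun U (latticePt k) f = (Real.sqrt |(U : Matrix (Fin d) (Fin d) ℝ).det| : ℂ) •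
        ((fun y => f (y - latticePt k)) ∘ act (U : Matrix (Fin d) (Fin d) ℝ)) := by
      ext x; simp [dilFun]
    have h2 : AEStronglyMeasurable (fun y => f (y - latticePt k)) volume :=
      (Lp.aestronglyMeasurable f).comp_measurePreserving hsub
    have h3 : eLpNorm (fun y => f (y - latticePt k)) 2 volume = eLpNorm f 2 volume :=
      eLpNorm_comp_measurePreserving (Lp.aestronglyMeasurable f) hsub
    rw [h1, eLpNorm_const_smul, ← eLpNorm_map_measure _ (continuous_act _).aemeasurable,
      map_act_volume hU, eLpNorm_smul_measure_of_ne_top ENNReal.ofNat_ne_top, h3, smul_eq_mul,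
      ← mul_assoc]
    · have h4 : ‖(Real.sqrt |(U : Matrix (Fin d) (Fin d) ℝ).det| : ℂ)‖ₑ
          * ENNReal.ofReal |(U : Matrix (Fin d) (Fin d) ℝ).det⁻¹| ^ (1 / (2 : ℝ≥0∞)).toReal
          = 1 := by
        have h5 : ‖(Real.sqrt |(U : Matrix (Fin d) (Fin d) ℝ).det| : ℂ)‖ₑ
            = ENNReal.ofReal (Real.sqrt |(U : Matrix (Fin d) (Fin d) ℝ).det|) := by
          rw [← ofReal_norm, Complex.norm_real, Real.norm_of_nonneg (Real.sqrt_nonneg _)]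
        have h6 : (1 / (2 : ℝ≥0∞)).toReal = 1 / 2 := by simp
        rw [h5, h6, ENNReal.ofReal_rpow_of_nonneg (abs_nonneg _) (by norm_num),
          ← Real.sqrt_eq_rpow, ← ENNReal.ofReal_mul (Real.sqrt_nonneg _),
          ← Real.sqrt_mul (abs_nonneg _), ← abs_mul, mul_inv_cancel₀ hU]
        simp
      rw [h4, one_mul]
    · rw [map_act_volume hU]
      exact h2.smul_measure _
  rw [dil, Lp.norm_toLp, key, Lp.norm_def]

/-- The unitary operator `f ↦ f_{U;k}`. -/
def dilₗᵢ (U : GL (Fin d) ℝ) : L2 d ≃ₗᵢ[ℂ] L2 d where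
  toFun := dil U 0
  invFun := dil U⁻¹ 0
  map_add' := dil_add U 0
  map_smul' := dil_smul U 0
  left_inv f := by rw [dil_dil U U⁻¹ 0 0 0 (by simp), mul_inv_cancel, dil_one_zero]
  right_inv f := by rw [dil_dil U⁻¹ U 0 0 0 (by simp), inv_mul_cancel, dil_one_zero]
  norm_map' := norm_dil U 0

@[simp] theorem dilₗᵢ_apply (U : GL (Fin d) ℝ) (f : L2 d) : dilₗᵢ U f = dil U 0 f := rfl

/-- The isometry `f ↦ f_{U;k}`. -/
def dilIsometry (U : GL (Fin d) ℝ) (k : Fin d → ℤ) : L2 d →ₗᵢ[ℂ] L2 d where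
  toFun := dil U k
  map_add' := dil_add U k
  map_smul' := dil_smul U k
  norm_map' := norm_dil U k

theorem inner_dil (U : GL (Fin d) ℝ) (k : Fin d → ℤ) (f g : L2 d) :
    inner ℂ (dil U k f) (dil U k g) = inner ℂ f g :=
  (dilIsometry U k).inner_map_map f g

/-- The index sets of the nonhomogeneous systems at the levels `J` and `K` correspond. -/
def nwIndexShift (d r s : ℕ) (J K : ℤ) : NWIndex d r s K ≃ NWIndex d r s J :=
  Equiv.sumCongr (Equiv.refl _) (Equiv.prodCongr (Equiv.refl _) (Equiv.prodCongr
    { toFun := fun j => ⟨j.1 + (J - K), by have := j.2; omega⟩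
      invFun := fun j => ⟨j.1 + (K - J), by have := j.2; omega⟩
      left_inv := fun j => Subtype.ext (by simp only; ring)
      right_inv := fun j => Subtype.ext (by simp only; ring) } (Equiv.refl _)))

theorem nonhomWS_shift {r s : ℕ} (M : GL (Fin d) ℝ) (φ : Fin r → L2 d) (ψ : Fin s → L2 d)
    (J K : ℤ) (p : NWIndex d r s K) :
    dilₗᵢ (M ^ (K - J)) (nonhomWS M φ ψ J (nwIndexShift d r s J K p)) = nonhomWS M φ ψ K p := by
  rcases p with p | p
  · simp only [nonhomWS, nwIndexShift, Equiv.sumCongr_apply, Sum.map_inl, Sum.elim_inl,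
      dilₗᵢ_apply]
    rw [dil_dil _ _ _ _ p.2 (by simp), ← _root_.zpow_add]
    simp
  · simp only [nonhomWS, nwIndexShift, Equiv.sumCongr_apply, Sum.map_inr, Sum.elim_inr,
      dilₗᵢ_apply]
    rw [dil_dil _ _ _ _ p.2.2 (by simp), ← _root_.zpow_add]
    have hj : (p.2.1 : ℤ) + (J - K) + (K - J) = p.2.1 := by ring
    simp [hj]

/-- Since the systems at different levels are dilates of each other, being a pair of biorthogonal
bases does not depend on the level. -/
theorem isBiorthogonalPair_nonhomWS_of_level {r s : ℕ} {M : GL (Fin d) ℝ} {φ φ' : Fin r → L2 d}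
    {ψ ψ' : Fin s → L2 d} {J : ℤ}
    (h : IsBiorthogonalPair (nonhomWS M φ ψ J) (nonhomWS M φ' ψ' J)) (K : ℤ) :
    IsBiorthogonalPair (nonhomWS M φ ψ K) (nonhomWS M φ' ψ' K) := by
  have := (h.comp_equiv (nwIndexShift d r s J K)).map (dilₗᵢ (M ^ (K - J)))
  simpa only [nonhomWS_shift] using this

/-! ### The Fourier transform of a dilate -/

/-- The character `ξ ↦ e^{-2πi y·ξ}`. -/
def modChar (y ξ : E d) : ℂ := (Real.fourierChar (-inner ℝ y ξ) : ℂ)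

theorem continuous_modChar (y : E d) : Continuous (modChar y) := by
  unfold modChar
  have : Continuous fun ξ : E d => Real.fourierChar (-inner ℝ y ξ) :=
    Real.continuous_fourierChar.comp (by fun_prop)
  exact continuous_subtype_val.comp this

theorem norm_modChar (y ξ : E d) : ‖modChar y ξ‖ = 1 := Circle.norm_coe _

theorem memLp_modChar_mul (y : E d) (f : L2 d) :
    MemLp (fun ξ => modChar y ξ * f ξ) 2 (volume : Measure (E d)) := by
  refine (Lp.memLp f).of_le ((continuous_modChar y).aestronglyMeasurable.mul
    (Lp.aestronglyMeasurable f)) (Filter.Eventually.of_forall fun ξ => ?_)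
  rw [norm_mul, norm_modChar, one_mul]

/-- Multiplication by the character `modChar y`, as an isometry of `L²`. -/
def modulation (y : E d) : L2 d →ₗᵢ[ℂ] L2 d where
  toFun f := (memLp_modChar_mul y f).toLp _
  map_add' f g := by
    apply Lp.ext
    filter_upwards [(memLp_modChar_mul y (f + g)).coeFn_toLp, (memLp_modChar_mul y f).coeFn_toLp,
      (memLp_modChar_mul y g).coeFn_toLp, Lp.coeFn_add f g,
      Lp.coeFn_add ((memLp_modChar_mul y f).toLp _) ((memLp_modChar_mul y g).toLp _)]
      with ξ h₁ h₂ h₃ h₄ h₅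
    rw [h₁, h₅, Pi.add_apply, h₂, h₃, h₄, Pi.add_apply, mul_add]
  map_smul' c f := by
    apply Lp.ext
    filter_upwards [(memLp_modChar_mul y (c • f)).coeFn_toLp, (memLp_modChar_mul y f).coeFn_toLp,
      Lp.coeFn_smul c f, Lp.coeFn_smul c ((memLp_modChar_mul y f).toLp _)]
      with ξ h₁ h₂ h₃ h₄
    rw [RingHom.id_apply, h₁, h₄, Pi.smul_apply, h₂, h₃, Pi.smul_apply, smul_eq_mul, smul_eq_mul,
      mul_left_comm]
  norm_map' f := by
    change ‖(memLp_modChar_mul y f).toLp _‖ = ‖f‖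
    rw [Lp.norm_toLp, Lp.norm_def]
    congr 1
    refine eLpNorm_congr_norm_ae (Filter.Eventually.of_forall fun ξ => ?_)
    rw [norm_mul, norm_modChar, one_mul]

theorem modulation_coeFn (y : E d) (f : L2 d) :
    modulation y f =ᵐ[volume] fun ξ => modChar y ξ * f ξ :=
  (memLp_modChar_mul y f).coeFn_toLp

/-- The transpose of an invertible matrix. -/
def glTranspose (U : GL (Fin d) ℝ) : GL (Fin d) ℝ :=
  Matrix.GeneralLinearGroup.mkOfDetNeZero (U : Matrix (Fin d) (Fin d) ℝ)ᵀ
    (by rw [Matrix.det_transpose]; exact det_ne_zero U)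

theorem coe_glTranspose (U : GL (Fin d) ℝ) :
    (glTranspose U : Matrix (Fin d) (Fin d) ℝ) = (U : Matrix (Fin d) (Fin d) ℝ)ᵀ := rfl

theorem inner_act_transpose (U : Matrix (Fin d) (Fin d) ℝ) (x y : E d) :
    inner ℝ x (act Uᵀ y) = inner ℝ (act U x) y := by
  simp only [EuclideanSpace.inner_eq_star_dotProduct, act, star_trivial]
  rw [Matrix.mulVec_transpose, ← Matrix.dotProduct_mulVec]

/-- The linear automorphism of `ℝ^d` given by an invertible matrix. -/
def actEquiv (U : GL (Fin d) ℝ) : E d ≃L[ℝ] E d :=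
  LinearEquiv.toContinuousLinearEquiv
    { Matrix.toLpLin 2 2 (U : Matrix (Fin d) (Fin d) ℝ) with
      invFun := act ((U⁻¹ : GL (Fin d) ℝ) : Matrix (Fin d) (Fin d) ℝ)
      left_inv := fun x => by
        change act _ (act _ x) = x
        rw [← act_mul, ← Units.val_mul, inv_mul_cancel, Units.val_one, act_one]
      right_inv := fun x => by
        change act _ (act _ x) = x
        rw [← act_mul, ← Units.val_mul, mul_inv_cancel, Units.val_one, act_one] }

theorem actEquiv_apply (U : GL (Fin d) ℝ) (x : E d) :
    actEquiv U x = act (U : Matrix (Fin d) (Fin d) ℝ) x := rfl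

/-- The Fourier integral of `f(Ux - k)` for a continuous function `f`. -/
theorem fourier_comp_act_sub (U : GL (Fin d) ℝ) (k : E d) {f : E d → ℂ} (hf : Continuous f)
    (ξ : E d) :
    𝓕 (fun x => f (act (U : Matrix (Fin d) (Fin d) ℝ) x - k))
        (act (U : Matrix (Fin d) (Fin d) ℝ)ᵀ ξ) =
      ((|(U : Matrix (Fin d) (Fin d) ℝ).det|⁻¹ : ℝ) : ℂ) * (modChar k ξ * 𝓕 f ξ) := by
  set A : Matrix (Fin d) (Fin d) ℝ := (U : Matrix (Fin d) (Fin d) ℝ) with hA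
  let G : E d → ℂ := fun y => Real.fourierChar (-inner ℝ y ξ) • f (y - k)
  have hG : Continuous G := by
    have : Continuous fun y : E d => Real.fourierChar (-inner ℝ y ξ) :=
      Real.continuous_fourierChar.comp (by fun_prop)
    exact this.smul (by fun_prop)
  have h1 : 𝓕 (fun x => f (act A x - k)) (act Aᵀ ξ) = ∫ x, G (act A x) := by
    rw [Real.fourier_eq]
    simp only [inner_act_transpose, G]
  have h2 : ∫ x, G (act A x) = |A.det|⁻¹ • ∫ y, G y := by
    have := integral_map (μ := (volume : Measure (E d))) (continuous_act A).aemeasurable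
      (f := G) hG.aestronglyMeasurable
    rw [← this, map_act_volume (det_ne_zero U), integral_smul_measure,
      ENNReal.toReal_ofReal (abs_nonneg _), abs_inv]
  have h3 : ∫ y, G y = modChar k ξ * 𝓕 f ξ := by
    rw [← integral_add_right_eq_self G k, Real.fourier_eq, ← integral_const_mul]
    refine integral_congr_ae (Filter.Eventually.of_forall fun y => ?_)
    simp only [G, add_sub_cancel_right, inner_add_left, neg_add, modChar]
    rw [AddChar.map_add_eq_mul, mul_comm, Circle.smul_def, Circle.smul_def, Circle.coe_mul,
      smul_eq_mul, smul_eq_mul, mul_assoc]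
  rw [h1, h2, h3, Complex.real_smul]

/-- The Fourier transform exchanges dilation by `U` with dilation by the inverse transpose of `U`,
and translation with modulation. It suffices to compare both sides on Schwartz functions. -/
theorem dil_fourier_dil (U : GL (Fin d) ℝ) (k : Fin d → ℤ) (f : L2 d) :
    dil (glTranspose U) 0 (𝓕 (dil U k f)) = modulation (latticePt k) (𝓕 f) := by
  refine DenseRange.induction_on
    (p := fun f : L2 d => dil (glTranspose U) 0 (𝓕 (dil U k f)) = modulation (latticePt k) (𝓕 f))
    (SchwartzMap.denseRange_toLpCLM (p := 2) ENNReal.ofNat_ne_top) f ?_ ?_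
  · apply isClosed_eq
    · exact (dilIsometry (glTranspose U) 0).continuous.comp
        ((Lp.fourierTransformₗᵢ (E d) ℂ).continuous.comp (dilIsometry U k).continuous)
    · exact (modulation (latticePt k)).continuous.comp (Lp.fourierTransformₗᵢ (E d) ℂ).continuous
  intro f
  rw [SchwartzMap.toLpCLM_apply]
  set c : ℝ := Real.sqrt |(U : Matrix (Fin d) (Fin d) ℝ).det| with hc
  let g : SchwartzMap (E d) ℂ := (c : ℂ) •
    SchwartzMap.compCLMOfContinuousLinearEquiv ℂ (actEquiv U)
      (SchwartzMap.compSubConstCLM ℂ (latticePt k) f)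
  have hg : ∀ x, g x = (c : ℂ) * f (act (U : Matrix (Fin d) (Fin d) ℝ) x - latticePt k) := by
    intro x
    simp [g, actEquiv_apply]
  have h1 : dil U k (f.toLp 2) = g.toLp 2 := by
    apply Lp.ext
    filter_upwards [dil_coeFn U k (f.toLp 2), g.coeFn_toLp 2 volume,
      (quasiMeasurePreserving_act_sub (det_ne_zero U) (latticePt k)).ae (f.coeFn_toLp 2 volume)]
      with x h₁ h₂ h₃
    rw [h₁, h₂, hg, dilFun, h₃]
  rw [h1, SchwartzMap.toLp_fourier_eq, SchwartzMap.toLp_fourier_eq]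
  apply Lp.ext
  have hT := quasiMeasurePreserving_act_sub (det_ne_zero (glTranspose U)) (latticePt 0)
  filter_upwards [dil_coeFn (glTranspose U) 0 ((𝓕 g).toLp 2),
    modulation_coeFn (latticePt k) ((𝓕 f).toLp 2), (𝓕 f).coeFn_toLp 2 volume,
    hT.ae ((𝓕 g).coeFn_toLp 2 volume)] with ξ h₁ h₂ h₃ h₄
  rw [h₁, h₂, h₃, dilFun, h₄, coe_glTranspose, Matrix.det_transpose, latticePt_zero, sub_zero,
    SchwartzMap.fourier_coe, SchwartzMap.fourier_coe]
  have h5 : (⇑g : E d → ℂ)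
      = (c : ℂ) • fun x => f (act (U : Matrix (Fin d) (Fin d) ℝ) x - latticePt k) := by
    ext x; simp [hg]
  have h6 : 𝓕 (⇑g : E d → ℂ) = (c : ℂ) •
      𝓕 (fun x => f (act (U : Matrix (Fin d) (Fin d) ℝ) x - latticePt k)) := by
    rw [h5]
    exact VectorFourier.fourierIntegral_const_smul _ _ _ _ _
  rw [h6, Pi.smul_apply, fourier_comp_act_sub U (latticePt k) f.continuous ξ, smul_eq_mul,
    ← mul_assoc, ← mul_assoc, ← hc]
  have h7 : (c : ℂ) * (c : ℂ) * ((|(U : Matrix (Fin d) (Fin d) ℝ).det|⁻¹ : ℝ) : ℂ) = 1 := by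
    rw [← Complex.ofReal_mul, ← Complex.ofReal_mul, hc, Real.mul_self_sqrt (abs_nonneg _),
      mul_inv_cancel₀ (abs_ne_zero.2 (det_ne_zero U)), Complex.ofReal_one]
  rw [h7, one_mul]

theorem quasiMeasurePreserving_smul {c : ℝ} (hc : c ≠ 0) :
    Measure.QuasiMeasurePreserving (fun x : E d => c • x) volume volume :=
  ⟨(continuous_const_smul c).measurable, by
    rw [Measure.map_addHaar_smul _ hc]; exact Measure.smul_absolutelyContinuous⟩

theorem hat_dil (U : GL (Fin d) ℝ) (k : Fin d → ℤ) (f : L2 d) :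
    ∀ᵐ ξ : E d, (Real.sqrt |(U : Matrix (Fin d) (Fin d) ℝ).det| : ℂ) *
        hat (dil U k f) (act (U : Matrix (Fin d) (Fin d) ℝ)ᵀ ξ) =
      modChar (latticePt k) ((2 * Real.pi)⁻¹ • ξ) * hat f ξ := by
  have h2pi : (2 * Real.pi)⁻¹ ≠ 0 := by positivity
  have h : dil (glTranspose U) 0 (𝓕 (dil U k f)) =ᵐ[volume] modulation (latticePt k) (𝓕 f) := by
    rw [dil_fourier_dil]
  filter_upwards [(quasiMeasurePreserving_smul h2pi).ae (h.symm.trans (dil_coeFn _ _ _)),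
    (quasiMeasurePreserving_smul h2pi).ae (modulation_coeFn (latticePt k) (𝓕 f))] with ξ h₁ h₂
  rw [h₂] at h₁
  rw [hat, hat, h₁, dilFun, coe_glTranspose, Matrix.det_transpose, latticePt_zero, sub_zero,
    act_smul]

/-! ### The torus and periodic functions -/

/-- The Haar probability measure on `ℝ / ℤ`, which is the normalisation used in Mathlib for
Fourier series on `UnitAddTorus`. -/
local instance circleMeasureSpace : MeasureSpace UnitAddCircle := ⟨AddCircle.haarAddCircle⟩

local instance circle_isAddHaarMeasure :
    Measure.IsAddHaarMeasure (volume : Measure UnitAddCircle) :=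
  inferInstanceAs (Measure.IsAddHaarMeasure AddCircle.haarAddCircle)

local instance circle_isProbabilityMeasure :
    IsProbabilityMeasure (volume : Measure UnitAddCircle) :=
  inferInstanceAs (IsProbabilityMeasure AddCircle.haarAddCircle)

open UnitAddTorus

/-- The covering map of `(ℝ/ℤ)^d` by `ℝ^d`, scaled to have periods `2πℤ^d`. -/
def toTorus (ξ : E d) : UnitAddTorus (Fin d) :=
  fun i => (((2 * Real.pi)⁻¹ * ξ i : ℝ) : UnitAddCircle)

theorem toTorus_add (ξ η : E d) : toTorus (ξ + η) = toTorus ξ + toTorus η := by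
  ext i
  simp only [toTorus, PiLp.add_apply, mul_add, AddCircle.coe_add, Pi.add_apply]

theorem toTorus_two_pi_smul (y : E d) :
    toTorus ((2 * Real.pi) • y) = fun i => ((y i : ℝ) : UnitAddCircle) := by
  ext i
  have : (2 * Real.pi) ≠ 0 := by positivity
  simp only [toTorus, PiLp.smul_apply, smul_eq_mul, inv_mul_cancel_left₀ this]

theorem toTorus_add_period (ξ : E d) (k : Fin d → ℤ) :
    toTorus (ξ + (2 * Real.pi) • latticePt k) = toTorus ξ := by
  rw [toTorus_add, toTorus_two_pi_smul]
  ext i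
  have : (((latticePt k : E d) i : ℝ) : UnitAddCircle) = 0 := by
    rw [AddCircle.coe_eq_zero_iff]
    exact ⟨k i, by simp [latticePt]⟩
  simp [this]

theorem continuous_toTorus : Continuous (toTorus (d := d)) := by
  refine continuous_pi fun i => ?_
  exact (AddCircle.continuous_mk' 1).comp (by fun_prop)

/-- The unit cell with corner `a`. -/
def unitCell (a : Fin d → ℝ) : Set (Fin d → ℝ) := {x | ∀ i, x i ∈ Set.Ioc (a i) (a i + 1)}

theorem measurableSet_unitCell (a : Fin d → ℝ) : MeasurableSet (unitCell a) :=
  MeasurableSet.univ_pi' fun _ => measurableSet_Ioc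

theorem measurable_coe_torus :
    Measurable (fun (x : Fin d → ℝ) => (fun i => (x i : UnitAddCircle) : UnitAddTorus (Fin d))) :=
  measurable_pi_lambda _ fun i => AddCircle.measurable_mk'.comp (measurable_pi_apply i)

theorem measurePreserving_coe_torus (a : Fin d → ℝ) :
    MeasurePreserving (fun (x : Fin d → ℝ) => (fun i => (x i : UnitAddCircle)
      : UnitAddTorus (Fin d))) (volume.restrict (unitCell a)) volume := by
  refine ⟨measurable_coe_torus, Measure.ext fun s hs => ?_⟩
  rw [Measure.map_apply measurable_coe_torus hs, ← lintegral_indicator_one hs,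
    lintegral_preimage _ a, ← lintegral_indicator_one (measurable_coe_torus hs)]
  rfl

theorem quasiMeasurePreserving_coe_torus :
    Measure.QuasiMeasurePreserving (fun (x : Fin d → ℝ) => (fun i => (x i : UnitAddCircle)
      : UnitAddTorus (Fin d))) volume volume := by
  refine ⟨measurable_coe_torus, Measure.AbsolutelyContinuous.mk fun s hs h0 => ?_⟩
  rw [Measure.map_apply measurable_coe_torus hs]
  have hcov : (Set.univ : Set (Fin d → ℝ)) = ⋃ k : Fin d → ℤ, unitCell fun i => (k i : ℝ) := by
    refine (Set.eq_univ_of_forall fun x => Set.mem_iUnion.2 ⟨fun i => ⌈x i⌉ - 1, fun i => ?_⟩).symm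
    have h1 := Int.le_ceil (x i)
    have h2 := Int.ceil_lt_add_one (x i)
    constructor <;> push_cast <;> linarith
  rw [← Set.inter_univ (_ ⁻¹' s), hcov, Set.inter_iUnion]
  refine measure_iUnion_null fun k => ?_
  have := (measurePreserving_coe_torus (d := d) fun i => (k i : ℝ)).measure_preimage
    hs.nullMeasurableSet
  rw [h0, Measure.restrict_apply (measurable_coe_torus hs)] at this
  exact this

/-- The linear part of `toTorus`. -/
def toPi (ξ : E d) : Fin d → ℝ := fun i => (2 * Real.pi)⁻¹ * ξ i

theorem map_toPi_volume : ∃ c : ℝ≥0∞, c ≠ ∞ ∧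
    Measurable (toPi (d := d)) ∧ Measure.map toPi (volume : Measure (E d)) = c • volume := by
  have h2pi : (2 * Real.pi)⁻¹ ≠ 0 := by positivity
  have hp : (toPi (d := d)) = (@WithLp.ofLp 2 (Fin d → ℝ)) ∘ fun ξ => (2 * Real.pi)⁻¹ • ξ := by
    ext ξ i; simp [toPi]
  have hm := PiLp.volume_preserving_ofLp (Fin d)
  have hs : Measurable fun ξ : E d => (2 * Real.pi)⁻¹ • ξ := measurable_const_smul _
  refine ⟨ENNReal.ofReal |((2 * Real.pi)⁻¹ ^ Module.finrank ℝ (E d))⁻¹|,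
    ENNReal.ofReal_ne_top, ?_, ?_⟩
  rotate_left
  · rw [hp, ← Measure.map_map hm.measurable hs, Measure.map_addHaar_smul _ h2pi,
      Measure.map_smul, hm.map_eq]
  · rw [hp]; exact hm.measurable.comp hs

theorem quasiMeasurePreserving_toTorus :
    Measure.QuasiMeasurePreserving (toTorus (d := d)) volume volume := by
  obtain ⟨c, -, hm, hc⟩ := map_toPi_volume (d := d)
  have : Measure.QuasiMeasurePreserving (toPi (d := d)) volume volume :=
    ⟨hm, by rw [hc]; exact Measure.smul_absolutelyContinuous⟩
  exact quasiMeasurePreserving_coe_torus.comp this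

theorem memLp_comp_toTorus {A : UnitAddTorus (Fin d) → ℂ} (hA : MemLp A 2 volume) :
    MemLp (fun ξ => A (toTorus ξ)) 2
      (volume.restrict {ξ : E d | ∀ i, ξ i ∈ Set.Ico (-Real.pi) Real.pi}) := by
  obtain ⟨c, hct, hm, hc⟩ := map_toPi_volume (d := d)
  have hqm : Measure.QuasiMeasurePreserving (toPi (d := d)) volume volume :=
    ⟨hm, by rw [hc]; exact Measure.smul_absolutelyContinuous⟩
  let a : Fin d → ℝ := fun _ => -(1 / 2)
  -- the half-open cells differ by a null set
  have hae : (toPi (d := d)) ⁻¹' (unitCell a) =ᵐ[volume]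
      {ξ : E d | ∀ i, ξ i ∈ Set.Ico (-Real.pi) Real.pi} := by
    have h1 : unitCell a = Set.pi Set.univ fun i => Set.Ioc (a i) (a i + 1) := by
      ext x; simp [unitCell]
    have h2 : {ξ : E d | ∀ i, ξ i ∈ Set.Ico (-Real.pi) Real.pi}
        = (toPi (d := d)) ⁻¹' (Set.pi Set.univ fun i => Set.Ico (a i) (a i + 1)) := by
      ext ξ
      simp only [Set.mem_ofPred_eq, Set.mem_preimage, Set.mem_univ_pi, toPi, a, Set.mem_Ico]
      refine forall_congr' fun i => ?_
      have hpi := Real.pi_pos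
      rw [inv_mul_eq_div, le_div_iff₀ (by positivity), div_lt_iff₀ (by positivity)]
      constructor <;> rintro ⟨h3, h4⟩ <;> constructor <;> linarith
    rw [h1, h2]
    exact hqm.preimage_ae_eq
      ((Measure.univ_pi_Ioc_ae_eq_Icc).trans (Measure.univ_pi_Ico_ae_eq_Icc).symm)
  rw [← Measure.restrict_congr_set hae]
  have h3 := hA.comp_measurePreserving (measurePreserving_coe_torus a)
  have h4 : Measure.map toPi ((volume : Measure (E d)).restrict (toPi ⁻¹' (unitCell a)))
      = c • volume.restrict (unitCell a) := by
    rw [← Measure.restrict_map hm (measurableSet_unitCell a), hc, Measure.restrict_smul]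
  have h5 := h3.smul_measure hct
  rw [← h4] at h5
  exact h5.comp_of_map hm.aemeasurable

theorem isPeriodicL2_comp_toTorus (A : Lp ℂ 2 (volume : Measure (UnitAddTorus (Fin d)))) :
    IsPeriodicL2 (fun ξ : E d => A (toTorus ξ)) :=
  ⟨(Lp.stronglyMeasurable A).measurable.comp continuous_toTorus.measurable,
    fun ξ k => by simp only [toTorus_add_period], memLp_comp_toTorus (Lp.memLp A)⟩

theorem mFourier_coe (n : Fin d → ℤ) (y : E d) :
    mFourier n (fun i => ((y i : ℝ) : UnitAddCircle)) =
      Complex.exp (2 * Real.pi * Complex.I * ((latticePt n ⬝ᵥ y : ℝ) : ℂ)) := by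
  simp only [mFourier, ContinuousMap.coe_mk, fourier_coe_apply, ← Complex.exp_sum]
  congr 1
  simp only [dotProduct, latticePt, Complex.ofReal_sum, Finset.mul_sum]
  refine Finset.sum_congr rfl fun i _ => ?_
  push_cast
  ring

theorem mFourier_toTorus (n : Fin d → ℤ) (ξ : E d) :
    mFourier n (toTorus ξ) = Complex.exp (Complex.I * ((latticePt n ⬝ᵥ ξ : ℝ) : ℂ)) := by
  have h := mFourier_coe n ((2 * Real.pi)⁻¹ • ξ)
  have h1 : toTorus ξ = fun i => ((((2 * Real.pi)⁻¹ • ξ) i : ℝ) : UnitAddCircle) := by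
    ext i; simp [toTorus]
  rw [h1, h]
  congr 1
  have hpi : (Real.pi : ℂ) ≠ 0 := by exact_mod_cast Real.pi_ne_zero
  simp only [WithLp.ofLp_smul, dotProduct_smul, smul_eq_mul]
  push_cast
  field_simp

theorem modChar_latticePt (k : Fin d → ℤ) (ξ : E d) :
    modChar (latticePt k) ((2 * Real.pi)⁻¹ • ξ) = mFourier (-k) (toTorus ξ) := by
  rw [mFourier_toTorus, modChar, Real.fourierChar_apply]
  congr 1
  have hpi : (Real.pi : ℂ) ≠ 0 := by exact_mod_cast Real.pi_ne_zero
  have h : (latticePt (-k) ⬝ᵥ ξ : ℝ) = -(latticePt k ⬝ᵥ ξ : ℝ) := by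
    simp [latticePt, dotProduct]
  rw [h, real_inner_smul_right, EuclideanSpace.inner_eq_star_dotProduct, star_trivial,
    dotProduct_comm]
  push_cast
  field_simp

/-- The Fourier series `∑ₖ c(k) e^{-2πi k·x}` on the torus, for `c ∈ ℓ²`. The sign matches the
Fourier transform of a translate. -/
def torusSeries (c : (Fin d → ℤ) → ℂ) : Lp ℂ 2 (volume : Measure (UnitAddTorus (Fin d))) :=
  ∑' k, c k • mFourierLp 2 (-k)

theorem hasSum_torusSeries {c : (Fin d → ℤ) → ℂ} (hc : Summable fun k => ‖c k‖ ^ 2) :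
    HasSum (fun k => c k • mFourierLp 2 (-k)) (torusSeries c) := by
  have hmem : Memℓp (fun k => c (-k)) 2 := by
    refine memℓp_gen ?_
    simpa [Function.comp_def] using (Equiv.neg (Fin d → ℤ)).summable_iff.2 hc
  have h := mFourierBasis.hasSum_repr_symm (⟨fun k => c (-k), hmem⟩ : lp (fun _ => ℂ) 2)
  rw [← (Equiv.neg (Fin d → ℤ)).hasSum_iff] at h
  have h2 : HasSum (fun k : Fin d → ℤ => c k • mFourierLp 2 (-k))
      (mFourierBasis.repr.symm (⟨fun k => c (-k), hmem⟩ : lp (fun _ => ℂ) 2)) := by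
    convert! h using 2 with k
    simp
  exact h2.summable.hasSum

theorem mFourierCoeff_torusSeries {c : (Fin d → ℤ) → ℂ} (hc : Summable fun k => ‖c k‖ ^ 2)
    (n : Fin d → ℤ) : mFourierCoeff (torusSeries c) n = c (-n) := by
  classical
  have h := (hasSum_torusSeries hc).mapL (innerSL ℂ (mFourierLp 2 n))
  rw [← mFourierBasis_repr, mFourierBasis.repr_apply_apply, coe_mFourierBasis]
  have h1 : ∀ k, innerSL ℂ (mFourierLp 2 n) (c k • mFourierLp 2 (-k))
      = if k = -n then c (-n) else 0 := by
    intro k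
    rw [innerSL_apply_apply, inner_smul_right, orthonormal_iff_ite.1 orthonormal_mFourier]
    by_cases hk : k = -n
    · simp [hk]
    · have : n ≠ -k := fun h => hk (by rw [h, neg_neg])
      simp [hk, this]
  simp only [h1] at h
  exact h.unique (hasSum_ite_eq (-n) (c (-n)))

/-- The Fourier coefficients of a product of two square integrable functions on the torus. -/
theorem hasSum_mFourierCoeff_mul {a b : (Fin d → ℤ) → ℂ} (ha : Summable fun k => ‖a k‖ ^ 2)
    (hb : Summable fun k => ‖b k‖ ^ 2) (n : Fin d → ℤ) :
    HasSum (fun k => a (k - n) * starRingEnd ℂ (b k))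
      (mFourierCoeff (fun x => torusSeries a x * starRingEnd ℂ (torusSeries b x)) n) := by
  have hmem : MemLp (fun x => mFourier (-n) x * torusSeries a x) 2 volume := by
    refine (Lp.memLp (torusSeries a)).of_le
      ((mFourier (-n)).continuous.aestronglyMeasurable.mul (Lp.aestronglyMeasurable _))
      (Filter.Eventually.of_forall fun x => ?_)
    rw [norm_mul]
    refine mul_le_of_le_one_left (norm_nonneg _) ?_
    exact ((mFourier (-n)).norm_coe_le_norm x).trans_eq mFourier_norm
  have h := hasSum_prod_mFourierCoeff (torusSeries b) (hmem.toLp _)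
  have h1 : ∀ k, mFourierCoeff (hmem.toLp _) k = a (-k - n) := by
    intro k
    rw [neg_sub_left, add_comm, ← mFourierCoeff_torusSeries ha (k + n)]
    refine integral_congr_ae ?_
    filter_upwards [hmem.coeFn_toLp] with x hx
    rw [hx, smul_eq_mul, smul_eq_mul, ← mul_assoc, ← mFourier_add, neg_add]
  simp only [h1, mFourierCoeff_torusSeries hb] at h
  rw [← (Equiv.neg (Fin d → ℤ)).hasSum_iff] at h
  have h2 : mFourierCoeff (fun x => torusSeries a x * starRingEnd ℂ (torusSeries b x)) n
      = ∫ t, starRingEnd ℂ (torusSeries b t) * hmem.toLp _ t := by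
    refine integral_congr_ae ?_
    filter_upwards [hmem.coeFn_toLp] with x hx
    rw [hx, smul_eq_mul]
    ring
  rw [h2]
  convert! h using 2 with k
  simp [mul_comm]

/-- An integrable function on the torus all of whose Fourier coefficients vanish is zero. -/
theorem ae_eq_zero_of_mFourierCoeff_eq_zero {f : UnitAddTorus (Fin d) → ℂ}
    (hf : Integrable f volume) (h : ∀ n, mFourierCoeff f n = 0) : f =ᵐ[volume] 0 := by
  have hint : ∀ g : C(UnitAddTorus (Fin d), ℂ), Integrable (fun x => g x * f x) volume := by
    intro g
    exact hf.bdd_mul g.continuous.aestronglyMeasurable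
      (Filter.Eventually.of_forall fun x => g.norm_coe_le_norm x)
  let L : C(UnitAddTorus (Fin d), ℂ) →ₗ[ℂ] ℂ :=
    { toFun := fun g => ∫ x, g x * f x
      map_add' := fun g₁ g₂ => by
        rw [← integral_add (hint g₁) (hint g₂)]
        simp [add_mul]
      map_smul' := fun c g => by
        rw [RingHom.id_apply, ← integral_smul]
        simp [mul_assoc] }
  have hL : Continuous L := by
    refine (L.mkContinuous (∫ x, ‖f x‖) fun g => ?_).continuous
    refine (norm_integral_le_integral_norm _).trans ?_
    rw [← integral_mul_const]
    refine integral_mono (hint g).norm (hf.norm.mul_const _) fun x => ?_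
    simp only [norm_mul]
    rw [mul_comm]
    exact mul_le_mul_of_nonneg_left (g.norm_coe_le_norm x) (norm_nonneg _)
  have hker : ∀ g, L g = 0 := by
    intro g
    have h1 : (⊤ : Submodule ℂ C(UnitAddTorus (Fin d), ℂ)) ≤ LinearMap.ker L := by
      rw [← span_mFourier_closure_eq_top]
      refine Submodule.topologicalClosure_minimal _ ?_ (isClosed_singleton.preimage hL)
      rw [Submodule.span_le]
      rintro _ ⟨n, rfl⟩
      have := h (-n)
      rw [mFourierCoeff, neg_neg] at this
      exact this
    exact h1 (Submodule.mem_top (x := g))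
  refine ae_eq_zero_of_forall_setIntegral_isClosed_eq_zero hf fun K hK => ?_
  -- approximate the indicator function of `K` by continuous functions
  have hδ : ∀ n : ℕ, (0 : ℝ) < 1 / ((n : ℝ) + 1) := fun n => by positivity
  let g : ℕ → C(UnitAddTorus (Fin d), ℂ) := fun n =>
    ⟨fun x => (((thickenedIndicator (hδ n) K x : NNReal) : ℝ) : ℂ), by fun_prop⟩
  have hlim : Filter.Tendsto (fun n => ∫ x, g n x * f x) Filter.atTop
      (nhds (∫ x, K.indicator f x)) := by
    refine tendsto_integral_of_dominated_convergence (fun x => ‖f x‖)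
      (fun n => (hint (g n)).aestronglyMeasurable) hf.norm (fun n => ?_) ?_
    · refine Filter.Eventually.of_forall fun x => ?_
      rw [norm_mul]
      refine mul_le_of_le_one_left (norm_nonneg _) ?_
      have : thickenedIndicator (hδ n) K x ≤ 1 := thickenedIndicator_le_one (hδ n) K x
      simpa [g] using this
    · refine Filter.Eventually.of_forall fun x => ?_
      have ht := tendsto_pi_nhds.1 (thickenedIndicator_tendsto_indicator_closure hδ
        tendsto_one_div_add_atTop_nhds_zero_nat K) x
      rw [hK.closure_eq] at ht
      have h3 : Filter.Tendsto (fun n => g n x) Filter.atTop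
          (nhds (((K.indicator (fun _ => (1 : NNReal)) x : NNReal) : ℝ) : ℂ)) := by
        exact (Complex.continuous_ofReal.tendsto _).comp
          ((NNReal.continuous_coe.tendsto _).comp ht)
      have h4 := h3.mul_const (f x)
      have h5 : (((K.indicator (fun _ => (1 : NNReal)) x : NNReal) : ℝ) : ℂ) * f x
          = K.indicator f x := by
        by_cases hx : x ∈ K <;> simp [hx]
      rwa [h5] at h4
  rw [← integral_indicator hK.measurableSet]
  refine tendsto_nhds_unique hlim ?_
  have : ∀ n, ∫ x, g n x * f x = 0 := fun n => hker (g n)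
  simp [this]

/-! ### Refinement equations -/

/-- The frequency form of an expansion `f = ∑ₖ c(k) φ_{M;k}`. The series on both sides converge in
`L²`, hence almost everywhere along a common subsequence of partial sums. -/
theorem hat_of_hasSum (M : GL (Fin d) ℝ) {φ f : L2 d} {c : (Fin d → ℤ) → ℂ}
    (hc : Summable fun k => ‖c k‖ ^ 2) (hf : HasSum (fun k => c k • dil M k φ) f) :
    ∀ᵐ ξ : E d, hat f (act (M : Matrix (Fin d) (Fin d) ℝ)ᵀ ξ) =
      (Real.sqrt |(M : Matrix (Fin d) (Fin d) ℝ).det| : ℂ)⁻¹ * torusSeries c (toTorus ξ) *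
        hat φ ξ := by
  have h2pi : (2 * Real.pi)⁻¹ ≠ 0 := by positivity
  have hq := quasiMeasurePreserving_smul (d := d) h2pi
  -- up to a constant, `F f` is the function `ξ ↦ f̂(Mᵀξ)`
  let F : L2 d →L[ℂ] L2 d := (dilₗᵢ (glTranspose M)).toLinearIsometry.toContinuousLinearMap.comp
    ((Lp.fourierTransformₗᵢ (E d) ℂ).toLinearIsometry.toContinuousLinearMap)
  have hF : ∀ g, F g = dil (glTranspose M) 0 (𝓕 g) := fun g => rfl
  have h1 : HasSum (fun k => c k • modulation (latticePt k) (𝓕 φ)) (F f) := by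
    have hk : ∀ k, F (c k • dil M k φ) = c k • modulation (latticePt k) (𝓕 φ) := fun k => by
      rw [map_smul, hF, dil_fourier_dil]
    simpa only [hk] using hf.mapL F
  have h2 := hasSum_torusSeries hc
  rw [HasSum, SummationFilter.unconditional_filter] at h1 h2
  obtain ⟨u, hu, h1u⟩ := (tendstoInMeasure_of_tendsto_Lp h1).exists_seq_tendsto_ae'
  obtain ⟨v, hv, h2v⟩ := (tendstoInMeasure_of_tendsto_Lp (h2.comp hu)).exists_seq_tendsto_ae'
  have h3 : ∀ᵐ ξ : E d, ∀ n, (∑ k ∈ u (v n), c k • modulation (latticePt k) (𝓕 φ) : L2 d) ξ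
      = ∑ k ∈ u (v n), c k * (modChar (latticePt k) ξ * (𝓕 φ : L2 d) ξ) := by
    refine ae_all_iff.2 fun n => ?_
    have h4 : ∀ᵐ ξ : E d, ∀ k, (c k • modulation (latticePt k) (𝓕 φ) : L2 d) ξ
        = c k * (modChar (latticePt k) ξ * (𝓕 φ : L2 d) ξ) := by
      refine ae_all_iff.2 fun k => ?_
      filter_upwards [Lp.coeFn_smul (c k) (modulation (latticePt k) (𝓕 φ)),
        modulation_coeFn (latticePt k) (𝓕 φ)] with ξ h₁ h₂
      rw [h₁, Pi.smul_apply, h₂, smul_eq_mul]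
    filter_upwards [h4, Lp.coeFn_fun_finsetSum (u (v n))
      fun k => c k • modulation (latticePt k) (𝓕 φ)] with ξ h₁ h₂
    rw [h₂]
    exact Finset.sum_congr rfl fun k _ => h₁ k
  have h5 : ∀ᵐ x : UnitAddTorus (Fin d), ∀ n,
      (∑ k ∈ u (v n), c k • mFourierLp 2 (-k) : Lp ℂ 2 (volume : Measure (UnitAddTorus (Fin d)))) x
      = ∑ k ∈ u (v n), c k * mFourier (-k) x := by
    refine ae_all_iff.2 fun n => ?_
    have h4 : ∀ᵐ x : UnitAddTorus (Fin d), ∀ k : Fin d → ℤ,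
        (c k • mFourierLp 2 (-k) : Lp ℂ 2 (volume : Measure (UnitAddTorus (Fin d)))) x
        = c k * mFourier (-k) x := by
      refine ae_all_iff.2 fun k => ?_
      filter_upwards [Lp.coeFn_smul (c k) (mFourierLp 2 (-k) :
        Lp ℂ 2 (volume : Measure (UnitAddTorus (Fin d)))), coeFn_mFourierLp 2 (-k)] with x h₁ h₂
      rw [h₁, Pi.smul_apply, h₂, smul_eq_mul]
    filter_upwards [h4, Lp.coeFn_fun_finsetSum (u (v n))
      fun k => (c k • mFourierLp 2 (-k) : Lp ℂ 2 (volume : Measure (UnitAddTorus (Fin d))))]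
      with x h₁ h₂
    rw [h₂]
    exact Finset.sum_congr rfl fun k _ => h₁ k
  filter_upwards [hq.ae h1u, hq.ae h3, hq.ae (dil_coeFn (glTranspose M) 0 (𝓕 f)),
    quasiMeasurePreserving_toTorus.ae h2v, quasiMeasurePreserving_toTorus.ae h5]
    with ξ e₁ e₃ e₄ e₂ e₅
  have e₁' := e₁.comp hv
  have hL : Filter.Tendsto (fun n => (∑ k ∈ u (v n), c k * mFourier (-k) (toTorus ξ)) * hat φ ξ)
      Filter.atTop (nhds (F f ((2 * Real.pi)⁻¹ • ξ))) := by
    refine e₁'.congr fun n => ?_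
    simp only [Function.comp_apply, e₃ n, Finset.sum_mul, modChar_latticePt]
    exact Finset.sum_congr rfl fun k _ => by rw [hat, mul_assoc]
  have hR : Filter.Tendsto (fun n => (∑ k ∈ u (v n), c k * mFourier (-k) (toTorus ξ)) * hat φ ξ)
      Filter.atTop (nhds (torusSeries c (toTorus ξ) * hat φ ξ)) := by
    refine Filter.Tendsto.mul_const _ (e₂.congr fun n => ?_)
    exact e₅ n
  have heq := tendsto_nhds_unique hL hR
  rw [hF, e₄, dilFun, coe_glTranspose, Matrix.det_transpose, latticePt_zero, sub_zero,
    act_smul] at heq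
  have hne : (Real.sqrt |(M : Matrix (Fin d) (Fin d) ℝ).det| : ℂ) ≠ 0 := by
    exact_mod_cast (Real.sqrt_pos.2 (abs_pos.2 (det_ne_zero M))).ne'
  rw [mul_assoc, ← heq, inv_mul_cancel_left₀ hne]
  rfl

theorem hat_sum {ι : Type} (S : Finset ι) (f : ι → L2 d) :
    ∀ᵐ ξ : E d, hat (∑ i ∈ S, f i) ξ = ∑ i ∈ S, hat (f i) ξ := by
  have h2pi : (2 * Real.pi)⁻¹ ≠ 0 := by positivity
  have h : (𝓕 (∑ i ∈ S, f i) : L2 d) = ∑ i ∈ S, 𝓕 (f i) :=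
    map_sum (Lp.fourierTransformₗᵢ (E d) ℂ) f S
  filter_upwards [(quasiMeasurePreserving_smul (d := d) h2pi).ae
    (Lp.coeFn_fun_finsetSum S fun i => (𝓕 (f i) : L2 d))] with ξ hξ
  simp only [hat]
  rw [h, hξ]

/-- The coefficients of `f` with respect to the first-level translates of the `φ`'s dual to
`φ'`. -/
def maskCoeff {r : ℕ} (M : GL (Fin d) ℝ) (φ' : Fin r → L2 d) (f : L2 d) (l : Fin r)
    (k : Fin d → ℤ) : ℂ :=
  inner ℂ (dil M k (φ' l)) f

/-- The periodic function through which `f̂(Mᵀξ)` is expressed by the `φ̂(ξ)`. -/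
def mask {r : ℕ} (M : GL (Fin d) ℝ) (φ' : Fin r → L2 d) (f : L2 d) (l : Fin r) (ξ : E d) : ℂ :=
  (Real.sqrt |(M : Matrix (Fin d) (Fin d) ℝ).det| : ℂ)⁻¹ *
    torusSeries (maskCoeff M φ' f l) (toTorus ξ)

theorem isPeriodicL2_mask {r : ℕ} (M : GL (Fin d) ℝ) (φ' : Fin r → L2 d) (f : L2 d) (l : Fin r) :
    IsPeriodicL2 (mask M φ' f l) := by
  obtain ⟨h1, h2, h3⟩ := isPeriodicL2_comp_toTorus (torusSeries (maskCoeff M φ' f l))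
  exact ⟨h1.const_mul _, fun ξ k => by simp only [mask, toTorus_add_period], h3.const_mul _⟩

section

variable {r s : ℕ} {M : GL (Fin d) ℝ} {φ φ' : Fin r → L2 d} {ψ ψ' : Fin s → L2 d}

/-- The index, in the nonhomogeneous system of level `0`, of the `k`-th translate of the `p`-th
among all generators. -/
def levelZeroIndex (p : Fin r ⊕ Fin s) (k : Fin d → ℤ) : NWIndex d r s 0 :=
  Sum.elim (fun i => Sum.inl (i, k)) (fun n => Sum.inr (n, ⟨0, le_refl 0⟩, k)) p

theorem nonhomWS_levelZeroIndex (M : GL (Fin d) ℝ) (φ : Fin r → L2 d) (ψ : Fin s → L2 d)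
    (p : Fin r ⊕ Fin s) (k : Fin d → ℤ) :
    nonhomWS M φ ψ 0 (levelZeroIndex p k) = dil 1 k (Sum.elim φ ψ p) := by
  rcases p with p | p <;> simp [levelZeroIndex, nonhomWS]

theorem levelZeroIndex_injective :
    Function.Injective fun q : (Fin r ⊕ Fin s) × (Fin d → ℤ) => levelZeroIndex q.1 q.2 := by
  rintro ⟨p | p, k⟩ ⟨q | q, l⟩ h <;> simp [levelZeroIndex] at h ⊢ <;> exact h

theorem nonhomWS_one_inl (M : GL (Fin d) ℝ) (φ : Fin r → L2 d) (ψ : Fin s → L2 d)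
    (q : Fin r × (Fin d → ℤ)) : nonhomWS M φ ψ 1 (Sum.inl q) = dil M q.2 (φ q.1) := by
  simp [nonhomWS]

theorem summable_sq_maskCoeff
    (h : IsBiorthogonalPair (nonhomWS M φ ψ 0) (nonhomWS M φ' ψ' 0)) (f : L2 d) (l : Fin r) :
    Summable fun k => ‖maskCoeff M φ' f l k‖ ^ 2 := by
  have h1 := (isBiorthogonalPair_nonhomWS_of_level h 1).summable_sq f
  have h2 := h1.comp_injective (i := fun k : Fin d → ℤ => Sum.inl (l, k))
    (fun k k' hk => by simpa using hk)
  simpa only [Function.comp_def, nonhomWS_one_inl, maskCoeff] using h2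

/-- A generator at level `0` is orthogonal to the dual wavelets of level at least `1`. -/
theorem inner_nonhomWS_inr_one
    (h : IsBiorthogonalPair (nonhomWS M φ ψ 0) (nonhomWS M φ' ψ' 0)) (p : Fin r ⊕ Fin s)
    (k : Fin d → ℤ) (q : Fin s × {j : ℤ // 1 ≤ j} × (Fin d → ℤ)) :
    inner ℂ (nonhomWS M φ' ψ' 1 (Sum.inr q)) (dil 1 k (Sum.elim φ ψ p)) = 0 := by
  have h1 := h.2.2 (levelZeroIndex p k) (Sum.inr (q.1, ⟨q.2.1.1, by have := q.2.1.2; omega⟩, q.2.2))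
  rw [nonhomWS_levelZeroIndex] at h1
  refine Eq.trans h1 (if_neg ?_)
  have := q.2.1.2
  rcases p with p | p
  · simp [levelZeroIndex]
  · simp only [levelZeroIndex, Sum.elim_inr, Sum.inr.injEq, Prod.mk.injEq, Subtype.mk.injEq,
      not_and]
    intro _ h0
    omega

/-- A generator at level `0` is a combination of the `φ_{M;k}` alone. -/
theorem hasSum_maskCoeff
    (h : IsBiorthogonalPair (nonhomWS M φ ψ 0) (nonhomWS M φ' ψ' 0)) (p : Fin r ⊕ Fin s)
    (k : Fin d → ℤ) :
    HasSum (fun q : Fin r × (Fin d → ℤ) =>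
      maskCoeff M φ' (dil 1 k (Sum.elim φ ψ p)) q.1 q.2 • dil M q.2 (φ q.1))
      (dil 1 k (Sum.elim φ ψ p)) := by
  have h1 := (isBiorthogonalPair_nonhomWS_of_level h 1).hasSum (dil 1 k (Sum.elim φ ψ p))
  rw [← Sum.inl_injective.hasSum_iff] at h1
  · simpa only [Function.comp_def, nonhomWS_one_inl, maskCoeff] using h1
  · rintro (q | q) hq
    · exact absurd ⟨q, rfl⟩ hq
    · rw [inner_nonhomWS_inr_one h, zero_smul]

theorem hat_act_transpose_eq_sum_mask
    (h : IsBiorthogonalPair (nonhomWS M φ ψ 0) (nonhomWS M φ' ψ' 0)) (p : Fin r ⊕ Fin s)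
    (k : Fin d → ℤ) :
    ∀ᵐ ξ : E d,
      Complex.exp (-Complex.I *
          ((latticePt k ⬝ᵥ act (M : Matrix (Fin d) (Fin d) ℝ)ᵀ ξ : ℝ) : ℂ)) *
        hat (Sum.elim φ ψ p) (act (M : Matrix (Fin d) (Fin d) ℝ)ᵀ ξ) =
      ∑ l, mask M φ' (dil 1 k (Sum.elim φ ψ p)) l ξ * hat (φ l) ξ := by
  have hdetT : (M : Matrix (Fin d) (Fin d) ℝ)ᵀ.det ≠ 0 := by
    rw [Matrix.det_transpose]; exact det_ne_zero M
  have hqT := quasiMeasurePreserving_act hdetT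
  set f := dil 1 k (Sum.elim φ ψ p) with hf
  have hs := hasSum_maskCoeff h p k
  have hl : ∀ l, Summable fun k' => maskCoeff M φ' f l k' • dil M k' (φ l) := fun l =>
    hs.summable.prod_factor l
  have hsum : ∑ l, ∑' k', maskCoeff M φ' f l k' • dil M k' (φ l) = f :=
    (hasSum_fintype _).unique (hs.prod_fiberwise fun l => (hl l).hasSum)
  have hall := ae_all_iff.2 fun l => hat_of_hasSum M (summable_sq_maskCoeff h f l) (hl l).hasSum
  filter_upwards [hall, hqT.ae (hat_sum Finset.univ
    fun l => ∑' k', maskCoeff M φ' f l k' • dil M k' (φ l)),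
    hqT.ae (hat_dil 1 k (Sum.elim φ ψ p))] with ξ h₁ h₂ h₃
  have h₄ : hat f (act (M : Matrix (Fin d) (Fin d) ℝ)ᵀ ξ)
      = ∑ l, mask M φ' f l ξ * hat (φ l) ξ := by
    rw [hsum] at h₂
    rw [h₂]
    exact Finset.sum_congr rfl fun l _ => h₁ l
  rw [← h₄]
  simp only [Units.val_one, Matrix.det_one, abs_one, Real.sqrt_one, Complex.ofReal_one, one_mul,
    Matrix.transpose_one, act_one] at h₃
  rw [hf, h₃, modChar_latticePt, mFourier_toTorus]
  congr 2
  simp [latticePt, dotProduct]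

end

/-! ### The frequency shifts of an integer matrix -/

theorem card_quotient_range_mulVec (N : Matrix (Fin d) (Fin d) ℤ) (hN : N.det ≠ 0) :
    Nat.card ((Fin d → ℤ) ⧸ LinearMap.range N.mulVecLin) = N.det.natAbs := by
  have hinj : Function.Injective N.mulVecLin := by
    refine (injective_iff_map_eq_zero _).2 fun v hv => Matrix.eq_zero_of_mulVec_eq_zero hN hv
  have h := Submodule.natAbs_det_equiv (LinearMap.range N.mulVecLin)
    (LinearEquiv.ofInjective N.mulVecLin hinj)
  rw [← h]
  congr 1
  have h2 : (LinearMap.range N.mulVecLin).subtype ∘ₗ AddMonoidHom.toIntLinearMap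
      ((LinearEquiv.ofInjective N.mulVecLin hinj : (Fin d → ℤ) →+ _)) = Matrix.toLin' N := by
    ext; rfl
  rw [h2, LinearMap.det_toLin']

theorem mFourier_apply_add (n : Fin d → ℤ) (x y : UnitAddTorus (Fin d)) :
    mFourier n (x + y) = mFourier n x * mFourier n y := by
  simp [mFourier, fourier_apply, smul_add, AddCircle.toCircle_add, Finset.prod_mul_distrib]

/-- The point `(Nᵀ)⁻¹ k` of the torus. -/
def freqPt (N : Matrix (Fin d) (Fin d) ℤ) : (Fin d → ℤ) →ₗ[ℤ] UnitAddTorus (Fin d) :=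
  AddMonoidHom.toIntLinearMap
    { toFun := fun k i =>
        ((act ((N.map (Int.cast : ℤ → ℝ))ᵀ)⁻¹ (latticePt k) i : ℝ) : UnitAddCircle)
      map_zero' := by ext i; simp
      map_add' := fun k l => by ext i; simp [latticePt_add, act_add] }

theorem freqPt_apply (N : Matrix (Fin d) (Fin d) ℤ) (k : Fin d → ℤ) (i : Fin d) :
    freqPt N k i = ((act ((N.map (Int.cast : ℤ → ℝ))ᵀ)⁻¹ (latticePt k) i : ℝ) : UnitAddCircle) :=
  rfl

section

variable {N : Matrix (Fin d) (Fin d) ℤ}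

theorem det_map_intCast (N : Matrix (Fin d) (Fin d) ℤ) :
    (N.map (Int.cast : ℤ → ℝ)).det = (N.det : ℝ) :=
  ((Int.castRingHom ℝ).map_det N).symm

theorem isUnit_det_map_intCast (hN : N.det ≠ 0) : IsUnit (N.map (Int.cast : ℤ → ℝ)).det := by
  rw [det_map_intCast, isUnit_iff_ne_zero]
  exact_mod_cast hN

theorem act_act_inv_transpose (hN : N.det ≠ 0) (y : E d) :
    act (N.map (Int.cast : ℤ → ℝ))ᵀ (act ((N.map (Int.cast : ℤ → ℝ))ᵀ)⁻¹ y) = y := by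
  rw [← act_mul, Matrix.mul_nonsing_inv _ (by
    rw [Matrix.det_transpose]; exact isUnit_det_map_intCast hN), act_one]

theorem act_inv_transpose_act (hN : N.det ≠ 0) (y : E d) :
    act ((N.map (Int.cast : ℤ → ℝ))ᵀ)⁻¹ (act (N.map (Int.cast : ℤ → ℝ))ᵀ y) = y := by
  rw [← act_mul, Matrix.nonsing_inv_mul _ (by
    rw [Matrix.det_transpose]; exact isUnit_det_map_intCast hN), act_one]

theorem latticePt_transpose_mulVec (n : Fin d → ℤ) :
    latticePt (Nᵀ *ᵥ n) = act (N.map (Int.cast : ℤ → ℝ))ᵀ (latticePt n) := by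
  rw [latticePt_mulVec, Matrix.transpose_map]

theorem ker_freqPt (hN : N.det ≠ 0) : LinearMap.ker (freqPt N) = LinearMap.range Nᵀ.mulVecLin := by
  ext k
  rw [LinearMap.mem_ker, LinearMap.mem_range]
  constructor
  · intro h
    have h1 : ∀ i, ∃ n : ℤ, n • (1 : ℝ) = act ((N.map (Int.cast : ℤ → ℝ))ᵀ)⁻¹ (latticePt k) i :=
      fun i => (AddCircle.coe_eq_zero_iff 1).1 (congrFun h i)
    choose n hn using h1
    refine ⟨n, latticePt_injective ?_⟩
    have h2 : latticePt n = act ((N.map (Int.cast : ℤ → ℝ))ᵀ)⁻¹ (latticePt k) := by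
      ext i
      rw [← hn i]
      simp [latticePt]
    rw [Matrix.mulVecLin_apply, latticePt_transpose_mulVec, h2, act_act_inv_transpose hN]
  · rintro ⟨n, rfl⟩
    ext i
    rw [freqPt_apply, Matrix.mulVecLin_apply, latticePt_transpose_mulVec,
      act_inv_transpose_act hN, Pi.zero_apply, AddCircle.coe_eq_zero_iff]
    exact ⟨n i, by simp [latticePt]⟩

theorem card_range_freqPt (hN : N.det ≠ 0) :
    Nat.card (LinearMap.range (freqPt N)) = N.det.natAbs := by
  rw [← Nat.card_congr (freqPt N).quotKerEquivRange.toEquiv, ker_freqPt hN,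
    card_quotient_range_mulVec _ (by rwa [Matrix.det_transpose]), Matrix.det_transpose]

theorem dotProduct_act_inv_transpose (n k : Fin d → ℤ) :
    (latticePt n ⬝ᵥ act ((N.map (Int.cast : ℤ → ℝ))ᵀ)⁻¹ (latticePt k) : ℝ) =
      ((N.map (Int.cast : ℤ → ℝ))⁻¹ *ᵥ (latticePt n).ofLp) ⬝ᵥ (latticePt k).ofLp := by
  simp only [act]
  rw [Matrix.dotProduct_mulVec, ← Matrix.transpose_nonsing_inv, Matrix.vecMul_transpose]

theorem mFourier_freqPt (n k : Fin d → ℤ) :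
    mFourier n (freqPt N k) = Complex.exp (2 * Real.pi * Complex.I *
      ((((N.map (Int.cast : ℤ → ℝ))⁻¹ *ᵥ (latticePt n).ofLp) ⬝ᵥ (latticePt k).ofLp : ℝ) : ℂ)) := by
  rw [← dotProduct_act_inv_transpose, ← mFourier_coe]
  rfl

theorem mFourier_mulVec_freqPt (hN : N.det ≠ 0) (j k : Fin d → ℤ) :
    mFourier (N *ᵥ j) (freqPt N k) = 1 := by
  have h1 : (N.map (Int.cast : ℤ → ℝ))⁻¹ *ᵥ (latticePt (N *ᵥ j)).ofLp = (latticePt j).ofLp := by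
    rw [latticePt_mulVec]
    simp only [act]
    rw [Matrix.mulVec_mulVec, Matrix.nonsing_inv_mul _ (isUnit_det_map_intCast hN),
      Matrix.one_mulVec]
  have h2 : ((latticePt j).ofLp ⬝ᵥ (latticePt k).ofLp : ℝ) = ((j ⬝ᵥ k : ℤ) : ℝ) := by
    simp [latticePt, dotProduct]
  rw [mFourier_freqPt, h1, h2]
  refine Complex.exp_eq_one_iff.2 ⟨j ⬝ᵥ k, ?_⟩
  push_cast
  ring

theorem exists_mulVec_eq_of_mFourier_freqPt (hN : N.det ≠ 0) {n : Fin d → ℤ}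
    (h : ∀ k, mFourier n (freqPt N k) = 1) : ∃ j, N *ᵥ j = n := by
  have h1 : ∀ i, ∃ j : ℤ, ((N.map (Int.cast : ℤ → ℝ))⁻¹ *ᵥ (latticePt n).ofLp) i = j := by
    intro i
    have h2 := h (Pi.single i 1)
    rw [mFourier_freqPt] at h2
    obtain ⟨j, hj⟩ := Complex.exp_eq_one_iff.1 h2
    refine ⟨j, ?_⟩
    have h3 : (latticePt (Pi.single i 1 : Fin d → ℤ)).ofLp = Pi.single i (1 : ℝ) := by
      ext l
      by_cases hl : l = i
      · subst hl; simp [latticePt]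
      · simp [latticePt, hl]
    rw [h3, dotProduct_single, mul_one, mul_comm (j : ℂ)] at hj
    exact_mod_cast mul_left_cancel₀ Complex.two_pi_I_ne_zero hj
  choose j hj using h1
  refine ⟨j, latticePt_injective ?_⟩
  have h2 : latticePt j = act (N.map (Int.cast : ℤ → ℝ))⁻¹ (latticePt n) := by
    ext i
    exact (hj i).symm
  rw [latticePt_mulVec, h2, ← act_mul, Matrix.mul_nonsing_inv _ (isUnit_det_map_intCast hN),
    act_one]

/-- Summing a Fourier character over the finite group of frequency shifts. -/
theorem sum_mFourier_range_freqPt (n : Fin d → ℤ) (hn : ¬ ∃ j, N *ᵥ j = n) (hN : N.det ≠ 0)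
    [Fintype (LinearMap.range (freqPt N))] :
    ∑ h : LinearMap.range (freqPt N), mFourier n (h : UnitAddTorus (Fin d)) = 0 := by
  obtain ⟨k, hk⟩ : ∃ k, mFourier n (freqPt N k) ≠ 1 := by
    by_contra! hall
    exact hn (exists_mulVec_eq_of_mFourier_freqPt hN hall)
  let h₀ : LinearMap.range (freqPt N) := ⟨freqPt N k, k, rfl⟩
  have h1 := Equiv.sum_comp (Equiv.addRight h₀)
    fun h : LinearMap.range (freqPt N) => mFourier n (h : UnitAddTorus (Fin d))
  simp only [Equiv.coe_addRight, Submodule.coe_add, mFourier_apply_add, ← Finset.sum_mul] at h1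
  by_contra hne
  exact hk (mul_left_cancel₀ hne (by rw [mul_one]; exact h1))

theorem mFourierCoeff_comp_add (F : UnitAddTorus (Fin d) → ℂ) (h : UnitAddTorus (Fin d))
    (n : Fin d → ℤ) :
    mFourierCoeff (fun x => F (x + h)) n = mFourier n h * mFourierCoeff F n := by
  rw [mFourierCoeff, mFourierCoeff, ← integral_const_mul,
    ← integral_add_right_eq_self (fun x => mFourier n h * (mFourier (-n) x • F x)) h]
  refine integral_congr_ae (Filter.Eventually.of_forall fun x => ?_)
  have h1 : mFourier n h * mFourier (-n) h = 1 := by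
    rw [← mFourier_add, add_neg_cancel, mFourier_zero, ContinuousMap.one_apply]
  simp only [smul_eq_mul, mFourier_apply_add]
  linear_combination (-(mFourier (-n) x * F (x + h))) * h1

theorem mFourierCoeff_const (c : ℂ) (n : Fin d → ℤ) :
    mFourierCoeff (fun _ : UnitAddTorus (Fin d) => c) n = if n = 0 then c else 0 := by
  classical
  have h1 := mFourierCoeff_toLp (mFourier (0 : Fin d → ℤ)) n
  have h2 := mFourierBasis_repr (mFourierLp 2 (0 : Fin d → ℤ)) n
  rw [← coe_mFourierBasis, mFourierBasis.repr_self, coe_mFourierBasis] at h2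
  have h3 : mFourierCoeff (fun _ : UnitAddTorus (Fin d) => c) n
      = c * mFourierCoeff (mFourier (0 : Fin d → ℤ)) n := by
    simp only [mFourierCoeff, smul_eq_mul, mFourier_zero, ContinuousMap.one_apply, mul_one]
    rw [← integral_const_mul]
    simp only [mul_comm]
  rw [h3, ← h1, ← h2, lp.single_apply]
  by_cases hn : n = 0 <;> simp [hn]

theorem integrable_mFourier_smul (n : Fin d → ℤ) {g : UnitAddTorus (Fin d) → ℂ}
    (hg : Integrable g volume) : Integrable (fun x => mFourier n x • g x) volume :=
  hg.bdd_mul (mFourier n).continuous.aestronglyMeasurable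
    (Filter.Eventually.of_forall fun x => (mFourier n).norm_coe_le_norm x)

theorem mFourierCoeff_sub {f g : UnitAddTorus (Fin d) → ℂ} (hf : Integrable f volume)
    (hg : Integrable g volume) (n : Fin d → ℤ) :
    mFourierCoeff (fun x => f x - g x) n = mFourierCoeff f n - mFourierCoeff g n := by
  rw [mFourierCoeff, mFourierCoeff, mFourierCoeff,
    ← integral_sub (integrable_mFourier_smul _ hf) (integrable_mFourier_smul _ hg)]
  simp only [smul_sub]

theorem mFourierCoeff_finsetSum {ι : Type} (S : Finset ι) {f : ι → UnitAddTorus (Fin d) → ℂ}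
    (hf : ∀ i ∈ S, Integrable (f i) volume) (n : Fin d → ℤ) :
    mFourierCoeff (fun x => ∑ i ∈ S, f i x) n = ∑ i ∈ S, mFourierCoeff (f i) n := by
  simp only [mFourierCoeff]
  rw [← integral_finsetSum _ fun i hi => integrable_mFourier_smul _ (hf i hi)]
  simp only [Finset.smul_sum]

/-- Periodizing over the frequency shifts keeps exactly the Fourier coefficients with index in
`Nℤ^d`. -/
theorem sum_range_freqPt_eq (hN : N.det ≠ 0) [Fintype (LinearMap.range (freqPt N))]
    {F : UnitAddTorus (Fin d) → ℂ} (hF : Integrable F volume) {c : ℂ}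
    (hc : ∀ j, mFourierCoeff F (N *ᵥ j) = if j = 0 then c else 0) :
    ∀ᵐ x, ∑ h : LinearMap.range (freqPt N), F (x + h) =
      (Nat.card (LinearMap.range (freqPt N)) : ℂ) * c := by
  generalize hm : (Nat.card (LinearMap.range (freqPt N)) : ℂ) = m
  have hFh : ∀ h : LinearMap.range (freqPt N),
      Integrable (fun x => F (x + (h : UnitAddTorus (Fin d)))) volume :=
    fun h => hF.comp_add_right (h : UnitAddTorus (Fin d))
  have hS : Integrable
      (fun x => ∑ h : LinearMap.range (freqPt N), F (x + (h : UnitAddTorus (Fin d)))) volume :=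
    integrable_finsetSum _ fun h _ => hFh h
  have hG := hS.sub (integrable_const (m * c))
  have h0 : ∀ n, mFourierCoeff (fun x => ∑ h : LinearMap.range (freqPt N),
      F (x + (h : UnitAddTorus (Fin d))) - m * c) n = 0 := by
    intro n
    rw [mFourierCoeff_sub hS (integrable_const _), mFourierCoeff_finsetSum _ fun h _ => hFh h,
      mFourierCoeff_const]
    simp only [mFourierCoeff_comp_add, ← Finset.sum_mul]
    by_cases hn : ∃ j, N *ᵥ j = n
    · obtain ⟨j, rfl⟩ := hn
      have h2 : ∀ h : LinearMap.range (freqPt N),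
          mFourier (N *ᵥ j) (h : UnitAddTorus (Fin d)) = 1 := by
        rintro ⟨_, k, rfl⟩
        exact mFourier_mulVec_freqPt hN j k
      have h3 : N *ᵥ j = 0 ↔ j = 0 :=
        ⟨fun h => Matrix.eq_zero_of_mulVec_eq_zero hN h, fun h => by rw [h, Matrix.mulVec_zero]⟩
      rw [hc, Finset.sum_congr rfl fun h _ => h2 h, Finset.sum_const, Finset.card_univ,
        ← Nat.card_eq_fintype_card, nsmul_one, hm]
      simp only [h3]
      by_cases hj : j = 0 <;> simp [hj]
    · have h3 : n ≠ 0 := fun h => hn ⟨0, by rw [h, Matrix.mulVec_zero]⟩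
      simp [sum_mFourier_range_freqPt n hn hN, h3]
  filter_upwards [ae_eq_zero_of_mFourierCoeff_eq_zero hG h0] with x hx
  exact sub_eq_zero.1 hx

theorem exists_eq_freqPt {M : GL (Fin d) ℝ}
    (hM : (M : Matrix (Fin d) (Fin d) ℝ) = N.map (Int.cast : ℤ → ℝ)) (ω : freqShifts M) :
    ∃ k, (ω : E d) = act ((N.map (Int.cast : ℤ → ℝ))ᵀ)⁻¹ (latticePt k) ∧
      toTorus ((2 * Real.pi) • (ω : E d)) = freqPt N k := by
  obtain ⟨ω, -, k, hk⟩ := ω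
  rw [hM] at hk
  refine ⟨k, hk, ?_⟩
  rw [toTorus_two_pi_smul]
  ext i
  change ((ω i : ℝ) : UnitAddCircle) = _
  rw [hk, freqPt_apply]

/-- The frequency shifts represent the points of the finite subgroup `(Nᵀ)⁻¹ℤ^d / ℤ^d` of the
torus. -/
def freqShiftsEquiv {M : GL (Fin d) ℝ}
    (hM : (M : Matrix (Fin d) (Fin d) ℝ) = N.map (Int.cast : ℤ → ℝ)) (hN : N.det ≠ 0) :
    freqShifts M ≃ LinearMap.range (freqPt N) :=
  Equiv.ofBijective
    (fun ω => ⟨toTorus ((2 * Real.pi) • (ω : E d)), by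
      obtain ⟨k, -, hk⟩ := exists_eq_freqPt hM ω
      exact ⟨k, hk.symm⟩⟩) <| by
    constructor
    · rintro ⟨ω, hω, k, hk⟩ ⟨ω', hω', k', hk'⟩ h
      have h1 : toTorus ((2 * Real.pi) • ω) = toTorus ((2 * Real.pi) • ω') :=
        congrArg Subtype.val h
      rw [toTorus_two_pi_smul, toTorus_two_pi_smul] at h1
      refine Subtype.ext ?_
      ext i
      have h2 : ω i ∈ Set.Ico (0 : ℝ) (0 + 1) := by simpa using hω i
      have h3 : ω' i ∈ Set.Ico (0 : ℝ) (0 + 1) := by simpa using hω' i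
      exact (AddCircle.coe_eq_coe_iff_of_mem_Ico h2 h3).1 (congrFun h1 i)
    · rintro ⟨_, k, rfl⟩
      set y := act ((N.map (Int.cast : ℤ → ℝ))ᵀ)⁻¹ (latticePt k) with hy
      let n : Fin d → ℤ := fun i => ⌊y i⌋
      refine ⟨⟨y - latticePt n, ?_, k - Nᵀ *ᵥ n, ?_⟩, Subtype.ext ?_⟩
      · intro i
        have h1 : (y - latticePt n) i = Int.fract (y i) := rfl
        rw [h1]
        exact ⟨Int.fract_nonneg _, Int.fract_lt_one _⟩
      · have h1 : latticePt (k - Nᵀ *ᵥ n) = latticePt k - latticePt (Nᵀ *ᵥ n) := by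
          ext i; simp [latticePt]
        rw [hM, h1, act_sub, latticePt_transpose_mulVec, act_inv_transpose_act hN]
      · change toTorus ((2 * Real.pi) • (y - latticePt n)) = freqPt N k
        rw [toTorus_two_pi_smul]
        ext i
        rw [freqPt_apply, ← hy]
        have h1 : (y - latticePt n) i = y i - n i := rfl
        have h2 : ((n i : ℝ) : UnitAddCircle) = 0 :=
          (AddCircle.coe_eq_zero_iff 1).2 ⟨n i, by simp⟩
        rw [h1, AddCircle.coe_sub, h2, sub_zero]

theorem freqShiftsEquiv_apply {M : GL (Fin d) ℝ}
    (hM : (M : Matrix (Fin d) (Fin d) ℝ) = N.map (Int.cast : ℤ → ℝ)) (hN : N.det ≠ 0)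
    (ω : freqShifts M) :
    (freqShiftsEquiv hM hN ω : UnitAddTorus (Fin d)) = toTorus ((2 * Real.pi) • (ω : E d)) := rfl

theorem card_freqShifts {M : GL (Fin d) ℝ}
    (hM : (M : Matrix (Fin d) (Fin d) ℝ) = N.map (Int.cast : ℤ → ℝ)) (hN : N.det ≠ 0) :
    Nat.card (freqShifts M) = N.det.natAbs := by
  rw [Nat.card_congr (freqShiftsEquiv hM hN), card_range_freqPt hN]

end

/-! ### The filter bank of an integer dilation -/

section

variable {r s : ℕ} {M : GL (Fin d) ℝ} {φ φ' : Fin r → L2 d} {ψ ψ' : Fin s → L2 d}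
  {N : Matrix (Fin d) (Fin d) ℤ}

/-- Translating by `j` shifts the coefficients by `N j`. -/
theorem maskCoeff_translate (hM : (M : Matrix (Fin d) (Fin d) ℝ) = N.map (Int.cast : ℤ → ℝ))
    (φ' : Fin r → L2 d) (f : L2 d) (l : Fin r) (j k : Fin d → ℤ) :
    maskCoeff M φ' (dil 1 j f) l k = maskCoeff M φ' f l (k - N *ᵥ j) := by
  have h : latticePt k = latticePt (k - N *ᵥ j) +
      act (M : Matrix (Fin d) (Fin d) ℝ) (latticePt j) := by
    rw [hM, ← latticePt_mulVec, ← latticePt_add, sub_add_cancel]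
  rw [maskCoeff, maskCoeff, ← inner_dil 1 j (dil M (k - N *ᵥ j) (φ' l)),
    dil_dil M 1 j (k - N *ᵥ j) k h, mul_one]

/-- Biorthogonality of the generators of level `0`, in terms of the coefficients. -/
theorem hasSum_maskCoeff_mul_conj
    (h : IsBiorthogonalPair (nonhomWS M φ ψ 0) (nonhomWS M φ' ψ' 0))
    (hM : (M : Matrix (Fin d) (Fin d) ℝ) = N.map (Int.cast : ℤ → ℝ))
    (p p' : Fin r ⊕ Fin s) (j : Fin d → ℤ) :
    HasSum (fun q : Fin r × (Fin d → ℤ) =>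
      maskCoeff M φ' (Sum.elim φ ψ p) q.1 (q.2 - N *ᵥ j) *
        starRingEnd ℂ (maskCoeff M φ (Sum.elim φ' ψ' p') q.1 q.2))
      (if j = 0 then if p = p' then 1 else 0 else 0) := by
  classical
  have h1 := (hasSum_maskCoeff h p j).mapL (innerSL ℂ (dil 1 0 (Sum.elim φ' ψ' p')))
  have h2 := h.2.2 (levelZeroIndex p j) (levelZeroIndex p' 0)
  rw [nonhomWS_levelZeroIndex, nonhomWS_levelZeroIndex] at h2
  have h3 : levelZeroIndex p j = levelZeroIndex p' 0 ↔ j = 0 ∧ p = p' := by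
    constructor
    · intro h
      have := levelZeroIndex_injective (a₁ := (p, j)) (a₂ := (p', 0)) h
      simp only [Prod.mk.injEq] at this
      exact this.symm
    · rintro ⟨rfl, rfl⟩; rfl
  have h4 : (if j = 0 then if p = p' then (1 : ℂ) else 0 else 0)
      = if j = 0 ∧ p = p' then 1 else 0 := by rw [ite_and]
  simp only [innerSL_apply_apply, inner_smul_right, maskCoeff_translate hM, h2, h3] at h1
  rw [h4]
  simpa only [dil_one_zero, maskCoeff, inner_conj_symm] using h1

/-- Biorthogonality of the `φ_{M;k}`, expanded over the generators of level `0`. -/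
theorem hasSum_maskCoeff_mul_conj_translates
    (h : IsBiorthogonalPair (nonhomWS M φ ψ 0) (nonhomWS M φ' ψ' 0))
    (hM : (M : Matrix (Fin d) (Fin d) ℝ) = N.map (Int.cast : ℤ → ℝ)) (l : Fin r) (k : Fin d → ℤ) :
    HasSum (fun q : (Fin r ⊕ Fin s) × (Fin d → ℤ) =>
      maskCoeff M φ' (Sum.elim φ ψ q.1) l (k - N *ᵥ q.2) *
        starRingEnd ℂ (maskCoeff M φ (Sum.elim φ' ψ' q.1) l (k - N *ᵥ q.2))) 1 := by
  have hone := isBiorthogonalPair_nonhomWS_of_level h 1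
  have h1 := h.hasSum_inner (dil M k (φ l)) (dil M k (φ' l))
  have h2 : inner ℂ (dil M k (φ' l)) (dil M k (φ l)) = (1 : ℂ) := by
    have := hone.2.2 (Sum.inl (l, k)) (Sum.inl (l, k))
    simpa only [nonhomWS_one_inl, if_true] using this
  rw [h2, ← levelZeroIndex_injective.hasSum_iff] at h1
  · convert! h1 using 2 with q
    simp only [Function.comp_apply, nonhomWS_levelZeroIndex, ← maskCoeff_translate hM]
    rw [maskCoeff, maskCoeff, inner_conj_symm]
  · intro i hi
    refine mul_eq_zero_of_right _ ?_
    rcases i with q | ⟨n, ⟨j, hj⟩, k'⟩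
    · exact absurd ⟨(Sum.inl q.1, q.2), rfl⟩ hi
    · have hj1 : 1 ≤ j := by
        by_contra hlt
        obtain rfl : j = 0 := by omega
        exact hi ⟨(Sum.inr n, k'), rfl⟩
      have h3 := hone.2.2 (Sum.inl (l, k)) (Sum.inr (n, ⟨j, hj1⟩, k'))
      rw [nonhomWS_one_inl, if_neg (by simp)] at h3
      exact h3

/-- The points of `ℤ^d` are uniquely `q - N j`, with `q` in a system of representatives modulo
`Nℤ^d`. -/
def quotientProdEquiv (hN : N.det ≠ 0) :
    ((Fin d → ℤ) ⧸ LinearMap.range N.mulVecLin) × (Fin d → ℤ) ≃ (Fin d → ℤ) :=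
  Equiv.ofBijective (fun q => Quotient.out q.1 - N *ᵥ q.2) <| by
    have hmk : ∀ q : ((Fin d → ℤ) ⧸ LinearMap.range N.mulVecLin) × (Fin d → ℤ),
        Submodule.Quotient.mk (p := LinearMap.range N.mulVecLin) (Quotient.out q.1 - N *ᵥ q.2)
          = q.1 := by
      intro q
      have h1 : Submodule.Quotient.mk (p := LinearMap.range N.mulVecLin) (N *ᵥ q.2) = 0 :=
        (Submodule.Quotient.mk_eq_zero _).2 ⟨q.2, rfl⟩
      rw [Submodule.Quotient.mk_sub, h1, sub_zero]
      exact Quotient.out_eq q.1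
    constructor
    · rintro ⟨q, j⟩ ⟨q', j'⟩ h
      have hq : q = q' := (hmk (q, j)).symm.trans ((congrArg _ h).trans (hmk (q', j')))
      subst hq
      have h2 : N *ᵥ (j - j') = 0 := by
        rw [Matrix.mulVec_sub, sub_eq_zero]
        exact sub_right_injective h
      rw [sub_eq_zero.1 (Matrix.eq_zero_of_mulVec_eq_zero hN h2)]
    · intro k
      have h1 : Quotient.out (Submodule.Quotient.mk (p := LinearMap.range N.mulVecLin) k) - k
          ∈ LinearMap.range N.mulVecLin := by
        rw [← Submodule.Quotient.eq]
        exact Quotient.out_eq _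
      obtain ⟨j, hj⟩ := h1
      refine ⟨(Submodule.Quotient.mk k, j), ?_⟩
      rw [Matrix.mulVecLin_apply] at hj
      simp only [hj, sub_sub_cancel]

/-- The number of generators: count the sum over `p`, `l`, `k` of the products of the coefficients
of the `p`-th generator and of its dual, either generator by generator or, with `k` grouped modulo
`Nℤ^d`, element by element of the first-level basis. -/
theorem card_generators (h : IsBiorthogonalPair (nonhomWS M φ ψ 0) (nonhomWS M φ' ψ' 0))
    (hM : (M : Matrix (Fin d) (Fin d) ℝ) = N.map (Int.cast : ℤ → ℝ)) (hN : N.det ≠ 0) :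
    r + s = r * N.det.natAbs := by
  classical
  let Q := (Fin d → ℤ) ⧸ LinearMap.range N.mulVecLin
  have hQ : Nat.card Q = N.det.natAbs := card_quotient_range_mulVec N hN
  have : Finite Q := Nat.finite_of_card_ne_zero (by rw [hQ]; exact Int.natAbs_ne_zero.2 hN)
  have : Fintype Q := Fintype.ofFinite Q
  let D : (Fin r ⊕ Fin s) → Fin r → (Fin d → ℤ) → ℂ := fun p l k =>
    maskCoeff M φ' (Sum.elim φ ψ p) l k * starRingEnd ℂ (maskCoeff M φ (Sum.elim φ' ψ' p) l k)
  have h1 : ∀ p, HasSum (fun q : Fin r × (Fin d → ℤ) => D p q.1 q.2) 1 := by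
    intro p
    have := hasSum_maskCoeff_mul_conj h hM p p 0
    simpa only [Matrix.mulVec_zero, sub_zero, if_true] using this
  have h2 : ∀ p l, Summable (D p l) := fun p l => (h1 p).summable.prod_factor l
  have h3 : ∀ p, ∑ l, ∑' k, D p l k = 1 := fun p =>
    (hasSum_fintype _).unique ((h1 p).prod_fiberwise fun l => (h2 p l).hasSum)
  have h4 : ∀ p l, HasSum (fun q : Q × (Fin d → ℤ) => D p l (Quotient.out q.1 - N *ᵥ q.2))
      (∑' k, D p l k) := fun p l =>
    (quotientProdEquiv hN).hasSum_iff.2 (h2 p l).hasSum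
  have h5 : ∀ p l (q : Q), Summable fun j => D p l (Quotient.out q - N *ᵥ j) := fun p l q =>
    (h4 p l).summable.prod_factor q
  have h6 : ∀ p l, ∑ q : Q, ∑' j, D p l (Quotient.out q - N *ᵥ j) = ∑' k, D p l k := fun p l =>
    (hasSum_fintype _).unique ((h4 p l).prod_fiberwise fun q => (h5 p l q).hasSum)
  have h7 : ∀ l (q : Q), ∑ p, ∑' j, D p l (Quotient.out q - N *ᵥ j) = 1 := fun l q =>
    (hasSum_fintype _).unique ((hasSum_maskCoeff_mul_conj_translates h hM l
      (Quotient.out q)).prod_fiberwise fun p => (h5 p l q).hasSum)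
  have h8 : ((r + s : ℕ) : ℂ) = ((r * N.det.natAbs : ℕ) : ℂ) := by
    calc ((r + s : ℕ) : ℂ) = ∑ p : Fin r ⊕ Fin s, ∑ l, ∑' k, D p l k := by simp [h3]
      _ = ∑ p : Fin r ⊕ Fin s, ∑ l, ∑ q : Q, ∑' j, D p l (Quotient.out q - N *ᵥ j) := by
        simp only [h6]
      _ = ∑ l, ∑ q : Q, ∑ p : Fin r ⊕ Fin s, ∑' j, D p l (Quotient.out q - N *ᵥ j) := by
        rw [Finset.sum_comm]
        exact Finset.sum_congr rfl fun l _ => Finset.sum_comm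
      _ = ((r * N.det.natAbs : ℕ) : ℂ) := by
        simp [h7, ← hQ, Nat.card_eq_fintype_card]
  exact_mod_cast h8

theorem integrable_torusSeries_mul_conj (a b : (Fin d → ℤ) → ℂ) :
    Integrable (fun x => torusSeries a x * starRingEnd ℂ (torusSeries b x)) volume := by
  have hb : MemLp (fun x => starRingEnd ℂ (torusSeries b x)) 2 volume := (Lp.memLp _).star
  exact (Lp.memLp (torusSeries a)).integrable_mul hb

/-- The rows of the two polyphase matrices are biorthogonal. -/
theorem sum_mask_mul_conj
    (h : IsBiorthogonalPair (nonhomWS M φ ψ 0) (nonhomWS M φ' ψ' 0))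
    (hM : (M : Matrix (Fin d) (Fin d) ℝ) = N.map (Int.cast : ℤ → ℝ)) (hN : N.det ≠ 0)
    [Fintype (freqShifts M)] (p p' : Fin r ⊕ Fin s) :
    ∀ᵐ ξ : E d, ∑ ω : freqShifts M, ∑ l,
      mask M φ' (Sum.elim φ ψ p) l (ξ + (2 * Real.pi) • (ω : E d)) *
        starRingEnd ℂ (mask M φ (Sum.elim φ' ψ' p') l (ξ + (2 * Real.pi) • (ω : E d))) =
      if p = p' then 1 else 0 := by
  classical
  have : Finite (LinearMap.range (freqPt N)) := Finite.of_equiv _ (freqShiftsEquiv hM hN)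
  have : Fintype (LinearMap.range (freqPt N)) := Fintype.ofFinite _
  let G : Fin r → UnitAddTorus (Fin d) → ℂ := fun l x =>
    torusSeries (maskCoeff M φ' (Sum.elim φ ψ p) l) x *
      starRingEnd ℂ (torusSeries (maskCoeff M φ (Sum.elim φ' ψ' p') l) x)
  have hG : ∀ l, Integrable (G l) volume := fun l => integrable_torusSeries_mul_conj _ _
  have hF : Integrable (fun x => ∑ l, G l x) volume := integrable_finsetSum _ fun l _ => hG l
  have hc : ∀ j, mFourierCoeff (fun x => ∑ l, G l x) (N *ᵥ j)
      = if j = 0 then if p = p' then 1 else 0 else 0 := by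
    intro j
    rw [mFourierCoeff_finsetSum _ fun l _ => hG l]
    have h1 := hasSum_maskCoeff_mul_conj h hM p p' j
    refine (hasSum_fintype _).unique (h1.prod_fiberwise fun l => ?_)
    exact hasSum_mFourierCoeff_mul (summable_sq_maskCoeff h _ l)
      (summable_sq_maskCoeff h.symm _ l) _
  filter_upwards [quasiMeasurePreserving_toTorus.ae (sum_range_freqPt_eq hN hF hc)] with ξ hξ
  rw [← Equiv.sum_comp (freqShiftsEquiv hM hN)] at hξ
  simp only [freqShiftsEquiv_apply, ← toTorus_add] at hξ
  rw [card_range_freqPt hN] at hξ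
  set δ := Real.sqrt |(M : Matrix (Fin d) (Fin d) ℝ).det| with hδ
  have hdet : (M : Matrix (Fin d) (Fin d) ℝ).det = (N.det : ℝ) := by rw [hM, det_map_intCast]
  have hδ2 : (δ : ℂ) * (δ : ℂ) = (N.det.natAbs : ℂ) := by
    have : δ * δ = (N.det.natAbs : ℝ) := by
      rw [hδ, Real.mul_self_sqrt (abs_nonneg _), hdet, Nat.cast_natAbs, Int.cast_abs]
    exact_mod_cast this
  have hm : (N.det.natAbs : ℂ) ≠ 0 := by exact_mod_cast Int.natAbs_ne_zero.2 hN
  have h2 : ∀ (ω : freqShifts M) (l : Fin r),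
      mask M φ' (Sum.elim φ ψ p) l (ξ + (2 * Real.pi) • (ω : E d)) *
        starRingEnd ℂ (mask M φ (Sum.elim φ' ψ' p') l (ξ + (2 * Real.pi) • (ω : E d)))
      = (N.det.natAbs : ℂ)⁻¹ * G l (toTorus (ξ + (2 * Real.pi) • (ω : E d))) := by
    intro ω l
    simp only [mask, G, map_mul, map_inv₀, Complex.conj_ofReal, ← hδ, ← hδ2, mul_inv]
    ring
  simp only [h2, ← Finset.mul_sum]
  rw [hξ, inv_mul_cancel_left₀ hm]

/-- The polyphase matrices are square and have biorthogonal rows, hence biorthogonal columns. -/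
theorem isDualFilterBank_mask
    (h : IsBiorthogonalPair (nonhomWS M φ ψ 0) (nonhomWS M φ' ψ' 0))
    (hM : (M : Matrix (Fin d) (Fin d) ℝ) = N.map (Int.cast : ℤ → ℝ)) (hN : N.det ≠ 0) :
    IsDualFilterBank M
      (fun ξ => Matrix.of fun i l => mask M φ (φ' i) l ξ)
      (fun ξ => Matrix.of fun i l => mask M φ (ψ' i) l ξ)
      (fun ξ => Matrix.of fun i l => mask M φ' (φ i) l ξ)
      (fun ξ => Matrix.of fun i l => mask M φ' (ψ i) l ξ) := by
  classical
  have hcard := card_freqShifts hM hN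
  have : Finite (freqShifts M) :=
    Nat.finite_of_card_ne_zero (by rw [hcard]; exact Int.natAbs_ne_zero.2 hN)
  have : Fintype (freqShifts M) := Fintype.ofFinite _
  have hc : Fintype.card (Fin r ⊕ Fin s) = Fintype.card (freqShifts M × Fin r) := by
    rw [Fintype.card_sum, Fintype.card_prod, Fintype.card_fin, Fintype.card_fin,
      ← Nat.card_eq_fintype_card (α := freqShifts M), hcard, card_generators h hM hN, mul_comm]
  have hall := ae_all_iff.2 fun p => ae_all_iff.2 fun p' => sum_mask_mul_conj h hM hN p p'
  filter_upwards [hall] with ξ hξ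
  refine (Matrix.mul_eq_one_comm_of_equiv (Fintype.equivOfCardEq hc)).1 ?_
  ext p p'
  rw [Matrix.mul_apply, Matrix.one_apply, ← hξ p p', Fintype.sum_prod_type]
  refine Finset.sum_congr rfl fun ω _ => Finset.sum_congr rfl fun l _ => ?_
  rcases p with p | p <;> rcases p' with p' | p' <;>
    simp [polyMatrix, Matrix.conjTranspose_apply]

end

/-! ### Powers of expansive matrices -/

section

attribute [local instance] Matrix.linftyOpNormedRing Matrix.linftyOpNormedAlgebra

/-- Gelfand's formula: the powers of a complex matrix of spectral radius less than one tend to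
zero. -/
theorem tendsto_matrix_pow_zero (hd : 0 < d) {B : Matrix (Fin d) (Fin d) ℂ}
    (hB : ∀ z ∈ spectrum ℂ B, ‖z‖ < 1) :
    Filter.Tendsto (fun n : ℕ => ‖B ^ n‖) Filter.atTop (nhds 0) := by
  have : Nonempty (Fin d) := ⟨⟨0, hd⟩⟩
  have : CompleteSpace (Matrix (Fin d) (Fin d) ℂ) := FiniteDimensional.complete ℂ _
  have h1 : spectralRadius ℂ B < ((1 : NNReal) : ℝ≥0∞) :=
    spectrum.spectralRadius_lt_of_forall_lt B fun z hz => by exact_mod_cast hB z hz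
  obtain ⟨q, hq1, hq2⟩ := ENNReal.lt_iff_exists_nnreal_btwn.1 h1
  have hq : (q : ℝ) < 1 := by exact_mod_cast hq2
  have h2 := (spectrum.pow_nnnorm_pow_one_div_tendsto_nhds_spectralRadius B).eventually_lt_const hq1
  refine squeeze_zero' (Filter.Eventually.of_forall fun n => norm_nonneg _) ?_
    (tendsto_pow_atTop_nhds_zero_of_lt_one q.2 hq)
  filter_upwards [h2, Filter.eventually_gt_atTop 0] with n hn hn0
  have hn' : (n : ℝ) ≠ 0 := by exact_mod_cast hn0.ne'
  have h3 := ENNReal.rpow_le_rpow hn.le (z := (n : ℝ)) (by positivity)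
  rw [← ENNReal.rpow_mul, one_div, inv_mul_cancel₀ hn', ENNReal.rpow_one, ENNReal.rpow_natCast]
    at h3
  exact_mod_cast h3

theorem tendsto_inv_pow_of_isExpansive (hd : 0 < d) {M : GL (Fin d) ℝ} (hM : IsExpansive M) :
    Filter.Tendsto (fun n : ℕ => (((M⁻¹ : GL (Fin d) ℝ) : Matrix (Fin d) (Fin d) ℝ)) ^ n)
      Filter.atTop (nhds 0) := by
  let B : GL (Fin d) ℂ := Units.map ((algebraMap ℝ ℂ).mapMatrix (m := Fin d)).toMonoidHom M
  have hB : (B : Matrix (Fin d) (Fin d) ℂ)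
      = (M : Matrix (Fin d) (Fin d) ℝ).map (algebraMap ℝ ℂ) := rfl
  have hBi : ((B⁻¹ : GL (Fin d) ℂ) : Matrix (Fin d) (Fin d) ℂ)
      = ((M⁻¹ : GL (Fin d) ℝ) : Matrix (Fin d) (Fin d) ℝ).map (algebraMap ℝ ℂ) := rfl
  have h1 : ∀ z ∈ spectrum ℂ ((B⁻¹ : GL (Fin d) ℂ) : Matrix (Fin d) (Fin d) ℂ), ‖z‖ < 1 := by
    intro z hz
    rw [← spectrum.map_inv, Set.mem_inv, hB] at hz
    have h2 := hM _ hz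
    have h3 : z ≠ 0 := by
      rintro rfl
      simp only [_root_.inv_zero, norm_zero] at h2
      linarith
    rw [norm_inv, one_lt_inv₀ (norm_pos_iff.2 h3)] at h2
    exact h2
  have h4 : Filter.Tendsto (fun n : ℕ => ((B⁻¹ : GL (Fin d) ℂ) : Matrix (Fin d) (Fin d) ℂ) ^ n)
      Filter.atTop (nhds 0) := tendsto_zero_iff_norm_tendsto_zero.2 (tendsto_matrix_pow_zero hd h1)
  refine tendsto_pi_nhds.2 fun i => tendsto_pi_nhds.2 fun j => ?_
  have h5 := tendsto_pi_nhds.1 (tendsto_pi_nhds.1 h4 i) j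
  have h6 := (Complex.continuous_re.tendsto _).comp h5
  refine h6.congr fun n => ?_
  rw [hBi]
  have h7 : (((M⁻¹ : GL (Fin d) ℝ) : Matrix (Fin d) (Fin d) ℝ).map (algebraMap ℝ ℂ)) ^ n
      = ((((M⁻¹ : GL (Fin d) ℝ) : Matrix (Fin d) (Fin d) ℝ)) ^ n).map (algebraMap ℝ ℂ) :=
    (((algebraMap ℝ ℂ).mapMatrix (m := Fin d)).map_pow _ n).symm
  simp only [Function.comp_apply, h7, Matrix.map_apply]
  rfl

end

/-- For an expansive matrix, the preimages of a bounded set under a high power lie in a small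
ball. -/
theorem exists_norm_le_of_isExpansive (hd : 0 < d) {M : GL (Fin d) ℝ} (hM : IsExpansive M)
    (R : ℝ) {ε : ℝ} (hε : 0 < ε) :
    ∃ n : ℕ, ∀ x : E d,
      ‖act ((M ^ n : GL (Fin d) ℝ) : Matrix (Fin d) (Fin d) ℝ) x‖ ≤ R → ‖x‖ ≤ ε := by
  have hcont : Continuous (Matrix.toEuclideanCLM (n := Fin d) (𝕜 := ℝ)) :=
    LinearMap.continuous_of_finiteDimensional
      ({ toFun := Matrix.toEuclideanCLM (n := Fin d) (𝕜 := ℝ)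
         map_add' := map_add _
         map_smul' := map_smul _ } : Matrix (Fin d) (Fin d) ℝ →ₗ[ℝ] (E d →L[ℝ] E d))
  have h1 := (hcont.tendsto 0).comp (tendsto_inv_pow_of_isExpansive hd hM)
  rw [map_zero] at h1
  have h2 := h1.norm.mul_const R
  rw [norm_zero, zero_mul] at h2
  obtain ⟨n, hn⟩ := (h2.eventually_le_const hε).exists
  refine ⟨n, fun x hx => le_trans ?_ hn⟩
  set A := Matrix.toEuclideanCLM (n := Fin d) (𝕜 := ℝ)
    (((M⁻¹ : GL (Fin d) ℝ) : Matrix (Fin d) (Fin d) ℝ) ^ n) with hA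
  have h3 : x = A (act ((M ^ n : GL (Fin d) ℝ) : Matrix (Fin d) (Fin d) ℝ) x) := by
    have h4 : ∀ y, A y = act (((M⁻¹ : GL (Fin d) ℝ) : Matrix (Fin d) (Fin d) ℝ) ^ n) y :=
      fun y => Matrix.toEuclideanCLM_toLp _ y.ofLp
    rw [h4, ← act_mul, ← Units.val_pow_eq_pow_val, ← Units.val_mul, inv_pow, inv_mul_cancel,
      Units.val_one, act_one]
  calc ‖x‖ = ‖A (act ((M ^ n : GL (Fin d) ℝ) : Matrix (Fin d) (Fin d) ℝ) x)‖ := by rw [← h3]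
    _ ≤ ‖A‖ * ‖act ((M ^ n : GL (Fin d) ℝ) : Matrix (Fin d) (Fin d) ℝ) x‖ := A.le_opNorm _
    _ ≤ ‖A‖ * R := by gcongr

/-! ### Density of the homogeneous system -/

theorem one_le_norm_latticePt_sub {k l : Fin d → ℤ} (h : k ≠ l) :
    1 ≤ ‖latticePt k - latticePt l‖ := by
  obtain ⟨i, hi⟩ := Function.ne_iff.1 h
  refine le_trans ?_ (PiLp.norm_apply_le (latticePt k - latticePt l) i)
  have h1 : (latticePt k - latticePt l) i = ((k i - l i : ℤ) : ℝ) := by simp [latticePt]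
  rw [h1, Real.norm_eq_abs]
  exact_mod_cast Int.one_le_abs (sub_ne_zero.2 hi)

/-- The `ε`-neighbourhood of the lattice `ℤ^d`. -/
def latticeNhd (d : ℕ) (ε : ℝ) : Set (E d) :=
  ⋃ k : Fin d → ℤ, Metric.closedBall (-latticePt k) ε

theorem biInter_latticeNhd_subset :
    ⋂ ε > (0 : ℝ), latticeNhd d ε ⊆ Set.range fun k : Fin d → ℤ => -latticePt k := by
  intro x hx
  simp only [latticeNhd, Set.mem_iInter, Set.mem_iUnion, Metric.mem_closedBall] at hx
  obtain ⟨k, hk⟩ := hx (1 / 4) (by norm_num)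
  refine ⟨k, (eq_of_forall_dist_le fun ε hε => ?_).symm⟩
  obtain ⟨l, hl⟩ := hx (min ε (1 / 4)) (lt_min hε (by norm_num))
  have hkl : l = k := by
    by_contra hne
    have h1 := one_le_norm_latticePt_sub hne
    have h2 : ‖latticePt l - latticePt k‖ = dist (-latticePt k) (-latticePt l) := by
      rw [dist_neg_neg, dist_comm, dist_eq_norm]
    have h3 := dist_triangle (-latticePt k) x (-latticePt l)
    rw [dist_comm _ x] at h3
    have := min_le_right ε (1 / 4 : ℝ)
    linarith
  rw [← hkl]
  exact hl.trans (min_le_left _ _)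

theorem tendsto_measure_latticeNhd (hd : 0 < d) (ν : Measure (E d)) [IsFiniteMeasure ν]
    (hν : ν ≪ volume) :
    Filter.Tendsto (fun ε => ν (latticeNhd d ε)) (nhdsWithin 0 (Set.Ioi 0)) (nhds 0) := by
  have : Nonempty (Fin d) := ⟨⟨0, hd⟩⟩
  have h1 := tendsto_measure_biInter_gt (μ := ν) (s := latticeNhd d) (a := 0)
    (fun ε _ => (MeasurableSet.iUnion fun k => Metric.isClosed_closedBall.measurableSet)
      |>.nullMeasurableSet)
    (fun i j _ hij => Set.iUnion_mono fun k => Metric.closedBall_subset_closedBall hij)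
    ⟨1, one_pos, measure_ne_top _ _⟩
  have h2 : ν (⋂ ε > (0 : ℝ), latticeNhd d ε) = 0 :=
    measure_mono_null biInter_latticeNhd_subset
      (hν ((Set.countable_range _).measure_zero _))
  rw [h2] at h1
  exact h1

/-- The integer translates of `φ` have small coefficients on functions supported near the origin:
these coefficients only see `φ` near the lattice `ℤ^d`, which is a null set. -/
theorem eventually_sum_inner_translate_le (hd : 0 < d) (φ : L2 d) {η : ℝ} (hη : 0 < η) :
    ∀ᶠ ε in nhdsWithin (0 : ℝ) (Set.Ioi 0), ∀ G : L2 d, (∀ᵐ x, ε < ‖x‖ → G x = 0) →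
      ∀ S : Finset (Fin d → ℤ), ∑ k ∈ S, ‖inner ℂ (dil 1 k φ) G‖ ^ 2 ≤ η * ‖G‖ ^ 2 := by
  let w : E d → ℝ≥0∞ := fun x => ‖φ x‖ₑ ^ 2
  have hw : Measurable w := (Lp.stronglyMeasurable φ).measurable.enorm.pow_const 2
  have hnorm : ∀ (f : L2 d), ENNReal.ofReal (‖f‖ ^ 2) = ∫⁻ x, ‖f x‖ₑ ^ 2 := by
    intro f
    have h1 := eLpNorm_nnreal_pow_eq_lintegral (f := f) (p := 2) (μ := volume) (by norm_num)
    rw [Lp.norm_def, ENNReal.ofReal_pow ENNReal.toReal_nonneg,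
      ENNReal.ofReal_toReal (Lp.eLpNorm_ne_top f)]
    simpa using h1
  let ν : Measure (E d) := volume.withDensity w
  have : IsFiniteMeasure ν := by
    refine isFiniteMeasure_withDensity ?_
    rw [← hnorm]
    exact ENNReal.ofReal_ne_top
  have h1 := tendsto_measure_latticeNhd hd ν (withDensity_absolutelyContinuous _ _)
  filter_upwards [h1.eventually_lt_const (ENNReal.ofReal_pos.2 hη),
    Ioo_mem_nhdsGT (show (0 : ℝ) < 1 / 4 by norm_num)] with ε hε hε4 G hG S
  let K : Set (E d) := Metric.closedBall 0 ε
  have hK : MeasurableSet K := Metric.isClosed_closedBall.measurableSet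
  -- since `G` vanishes off `K`, the translates of `φ` may be cut off outside `K`
  let g : (Fin d → ℤ) → L2 d := fun k => ((Lp.memLp (dil 1 k φ)).indicator hK).toLp _
  have hg : ∀ k, inner ℂ (dil 1 k φ) G = inner ℂ (g k) G := by
    intro k
    rw [L2.inner_def, L2.inner_def]
    refine integral_congr_ae ?_
    filter_upwards [hG, ((Lp.memLp (dil 1 k φ)).indicator hK).coeFn_toLp] with x h₁ h₂
    rw [h₂]
    by_cases hx : x ∈ K
    · rw [Set.indicator_of_mem hx]
    · have : ε < ‖x‖ := by simpa [K] using hx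
      simp [h₁ this]
  have hgn : ∀ k, ENNReal.ofReal (‖g k‖ ^ 2) = ν (Metric.closedBall (-latticePt k) ε) := by
    intro k
    have hpre : K = (fun x => x - latticePt k) ⁻¹' Metric.closedBall (-latticePt k) ε := by
      ext x
      simp [K, dist_eq_norm]
    rw [hnorm, withDensity_apply _ Metric.isClosed_closedBall.measurableSet,
      ← (measurePreserving_sub_right volume (latticePt k)).setLIntegral_comp_preimage
        Metric.isClosed_closedBall.measurableSet hw, ← hpre, ← lintegral_indicator hK]
    refine lintegral_congr_ae ?_
    filter_upwards [((Lp.memLp (dil 1 k φ)).indicator hK).coeFn_toLp, dil_coeFn 1 k φ] with x h₁ h₂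
    rw [h₁]
    by_cases hx : x ∈ K
    · rw [Set.indicator_of_mem hx, Set.indicator_of_mem hx, h₂]
      simp [w, dilFun]
    · simp [hx]
  -- distinct lattice points are at distance at least `1`, and `ε < 1 / 4`
  have hdisj : (S : Set (Fin d → ℤ)).PairwiseDisjoint
      fun k => Metric.closedBall (-latticePt k) ε := by
    intro k _ l _ hkl
    refine Metric.closedBall_disjoint_closedBall ?_
    have h3 := one_le_norm_latticePt_sub hkl
    rw [dist_neg_neg, dist_eq_norm]
    have := hε4.2
    linarith
  have hsum : ∑ k ∈ S, ‖g k‖ ^ 2 ≤ η := by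
    rw [← ENNReal.ofReal_le_ofReal_iff hη.le,
      ENNReal.ofReal_sum_of_nonneg fun _ _ => by positivity]
    simp only [hgn]
    rw [← measure_biUnion_finset hdisj fun _ _ => Metric.isClosed_closedBall.measurableSet]
    refine (measure_mono ?_).trans hε.le
    exact Set.iUnion₂_subset fun k _ => Set.subset_iUnion
      (fun k : Fin d → ℤ => Metric.closedBall (-latticePt k) ε) k
  calc ∑ k ∈ S, ‖inner ℂ (dil 1 k φ) G‖ ^ 2 ≤ ∑ k ∈ S, ‖g k‖ ^ 2 * ‖G‖ ^ 2 := by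
        refine Finset.sum_le_sum fun k _ => ?_
        rw [hg, ← mul_pow]
        exact pow_le_pow_left₀ (norm_nonneg _) (norm_inner_le_norm _ _) 2
    _ = (∑ k ∈ S, ‖g k‖ ^ 2) * ‖G‖ ^ 2 := by rw [Finset.sum_mul]
    _ ≤ η * ‖G‖ ^ 2 := by gcongr

theorem exists_boundedSupport_norm_sub_le (f : L2 d) {δ : ℝ} (hδ : 0 < δ) :
    ∃ (g : L2 d) (R : ℝ), (∀ᵐ x, R < ‖x‖ → g x = 0) ∧ ‖f - g‖ ≤ δ := by
  obtain ⟨g, hg, hfg, -, hgm⟩ := (Lp.memLp f).exists_hasCompactSupport_eLpNorm_sub_le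
    ENNReal.ofNat_ne_top (ENNReal.ofReal_pos.2 hδ).ne'
  obtain ⟨R, hR⟩ := hg.isCompact.isBounded.subset_closedBall (0 : E d)
  refine ⟨hgm.toLp g, R, ?_, ?_⟩
  · filter_upwards [hgm.coeFn_toLp] with x hx hRx
    rw [hx]
    refine image_eq_zero_of_notMem_tsupport fun hxs => ?_
    have := hR hxs
    rw [mem_closedBall_zero_iff] at this
    linarith
  · have h1 : f - hgm.toLp g = ((Lp.memLp f).sub hgm).toLp _ := by
      conv_lhs => rw [← Lp.toLp_coeFn f (Lp.memLp f)]
      rfl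
    rw [h1, Lp.norm_toLp]
    exact ENNReal.toReal_le_of_le_ofReal hδ.le hfg

section

variable {r s : ℕ} {M : GL (Fin d) ℝ} {φ φ' : Fin r → L2 d} {ψ ψ' : Fin s → L2 d}

/-- A function orthogonal to all `ψ_{M^j;k}` vanishes. After a dilation by a high power of `M` it is
controlled by its coefficients with respect to the translates of the `φ`'s, and it is
concentrated near the origin, so that these coefficients are small. -/
theorem eq_zero_of_forall_inner_homWS_eq_zero (hd : 0 < d) (hM : IsExpansive M)
    (h : IsBiorthogonalPair (nonhomWS M φ ψ 0) (nonhomWS M φ' ψ' 0)) {f : L2 d}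
    (hf : ∀ p, inner ℂ (homWS M ψ p) f = 0) : f = 0 := by
  obtain ⟨C, hC0, hC⟩ := h.symm.exists_norm_le
  obtain ⟨B, hB0, hB⟩ := h.symm.exists_bessel
  have key : ∀ t : ℝ, 0 < t → ‖f‖ ^ 2 ≤ C * (2 * (t + B * t)) := by
    intro t ht
    obtain ⟨g, R, hgR, hfg⟩ := exists_boundedSupport_norm_sub_le f (Real.sqrt_pos.2 ht)
    -- small enough for the contributions of all `r` generators to add up to at most `t`
    let η : ℝ := t / ((r + 1) * (‖g‖ ^ 2 + 1))
    have hη : 0 < η := by positivity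
    obtain ⟨ε, hε, hε0⟩ := ((Filter.eventually_all.2 fun l =>
      eventually_sum_inner_translate_le hd (φ l) hη).and
        (self_mem_nhdsWithin (a := (0 : ℝ)) (s := Set.Ioi 0))).exists
    obtain ⟨n, hn⟩ := exists_norm_le_of_isExpansive hd hM R hε0
    let D := dilₗᵢ (M ^ n)
    have hDg : ∀ᵐ x, ε < ‖x‖ → D g x = 0 := by
      filter_upwards [dil_coeFn (M ^ n) 0 g,
        (quasiMeasurePreserving_act (det_ne_zero (M ^ n))).ae hgR] with x h₁ h₂ hx
      have h₃ : R < ‖act ((M ^ n : GL (Fin d) ℝ) : Matrix (Fin d) (Fin d) ℝ) x‖ := by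
        by_contra hle
        exact absurd (hn x (not_lt.1 hle)) (not_le.2 hx)
      change dil (M ^ n) 0 g x = 0
      rw [h₁, dilFun, latticePt_zero, sub_zero, h₂ h₃, mul_zero]
    have hDf : ∀ q, inner ℂ (nonhomWS M φ ψ 0 (Sum.inr q)) (D f) = 0 := by
      intro q
      have h1 := hf (q.1, q.2.1 - (n : ℤ), q.2.2)
      rw [homWS, ← inner_dil (M ^ n) 0, dil_dil _ _ _ _ q.2.2 (by simp), ← zpow_natCast,
        ← _root_.zpow_add, sub_add_cancel, zpow_natCast] at h1
      exact h1
    have hsm : ∑' i, ‖inner ℂ (nonhomWS M φ ψ 0 i) (D f)‖ ^ 2 ≤ 2 * (t + B * t) := by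
      refine (h.symm.summable_sq (D f)).tsum_le_of_sum_le fun S => ?_
      have h1 : ∀ i, ‖inner ℂ (nonhomWS M φ ψ 0 i) (D f)‖ ^ 2
          ≤ 2 * (Sum.elim (fun q : Fin r × (Fin d → ℤ) => ‖inner ℂ (dil 1 q.2 (φ q.1)) (D g)‖ ^ 2)
            (fun _ => 0) i + ‖inner ℂ (nonhomWS M φ ψ 0 i) (D (f - g))‖ ^ 2) := by
        rintro (q | q)
        · have h2 : D f = D g + D (f - g) := by rw [← map_add]; congr 1; abel
          have h3 : nonhomWS M φ ψ 0 (Sum.inl q) = dil 1 q.2 (φ q.1) := by simp [nonhomWS]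
          rw [h2, inner_add_right, h3, Sum.elim_inl]
          refine (pow_le_pow_left₀ (norm_nonneg _) (norm_add_le _ _) 2).trans ?_
          exact add_sq_le
        · rw [hDf]
          simp only [norm_zero, Sum.elim_inr, zero_add, ne_eq, OfNat.ofNat_ne_zero,
            not_false_eq_true, zero_pow]
          positivity
      refine (Finset.sum_le_sum fun i _ => h1 i).trans ?_
      rw [← Finset.mul_sum, Finset.sum_add_distrib]
      have h4 : ∑ i ∈ S, ‖inner ℂ (nonhomWS M φ ψ 0 i) (D (f - g))‖ ^ 2 ≤ B * t := by
        refine (hB _ S).trans ?_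
        rw [LinearIsometryEquiv.norm_map]
        refine mul_le_mul_of_nonneg_left ?_ hB0.le
        rw [← Real.sq_sqrt ht.le]
        exact pow_le_pow_left₀ (norm_nonneg _) hfg 2
      have h5 : ∑ i ∈ S, Sum.elim (fun q : Fin r × (Fin d → ℤ) =>
          ‖inner ℂ (dil 1 q.2 (φ q.1)) (D g)‖ ^ 2) (fun _ => 0) i ≤ t := by
        classical
        have h6 : ∑ i ∈ S, Sum.elim (fun q : Fin r × (Fin d → ℤ) =>
            ‖inner ℂ (dil 1 q.2 (φ q.1)) (D g)‖ ^ 2) (fun _ => 0) i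
            = ∑ q ∈ S.toLeft, ‖inner ℂ (dil 1 q.2 (φ q.1)) (D g)‖ ^ 2 := by
          conv_lhs => rw [← Finset.toLeft_disjSum_toRight (u := S)]
          rw [Finset.sum_disjSum]
          simp
        rw [h6]
        calc ∑ q ∈ S.toLeft, ‖inner ℂ (dil 1 q.2 (φ q.1)) (D g)‖ ^ 2
            ≤ ∑ q ∈ Finset.univ ×ˢ (S.toLeft.image Prod.snd),
              ‖inner ℂ (dil 1 q.2 (φ q.1)) (D g)‖ ^ 2 := by
              refine Finset.sum_le_sum_of_subset_of_nonneg (fun q hq => ?_)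
                fun _ _ _ => by positivity
              exact Finset.mem_product.2 ⟨Finset.mem_univ _, Finset.mem_image_of_mem _ hq⟩
          _ = ∑ l, ∑ k ∈ S.toLeft.image Prod.snd, ‖inner ℂ (dil 1 k (φ l)) (D g)‖ ^ 2 :=
              Finset.sum_product _ _ _
          _ ≤ ∑ _l : Fin r, η * ‖D g‖ ^ 2 := Finset.sum_le_sum fun l _ => hε l (D g) hDg _
          _ = r * (η * ‖g‖ ^ 2) := by
              rw [LinearIsometryEquiv.norm_map]; simp
          _ ≤ (r + 1) * (η * (‖g‖ ^ 2 + 1)) := by gcongr <;> linarith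
          _ = t := by simp only [η]; field_simp
      linarith
    calc ‖f‖ ^ 2 = ‖D f‖ ^ 2 := by rw [LinearIsometryEquiv.norm_map]
      _ ≤ C * ∑' i, ‖inner ℂ (nonhomWS M φ ψ 0 i) (D f)‖ ^ 2 := hC _
      _ ≤ C * (2 * (t + B * t)) := by gcongr
  have hle : ‖f‖ ^ 2 ≤ 0 := by
    refine le_of_forall_pos_le_add fun e he => ?_
    have h1 := key (e / (C * (2 * (1 + B)))) (by positivity)
    have h2 : C * (2 * (e / (C * (2 * (1 + B))) + B * (e / (C * (2 * (1 + B)))))) = 0 + e := by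
      field_simp
      ring
    rwa [h2] at h1
  have := pow_eq_zero_iff (two_ne_zero) |>.1 (le_antisymm hle (sq_nonneg _))
  exact norm_eq_zero.1 this

end

/-! ### Homogeneous bases, refinement masks and the number of wavelets -/

section

variable {r s : ℕ} {M : GL (Fin d) ℝ} {φ φ' : Fin r → L2 d} {ψ ψ' : Fin s → L2 d}

theorem homWS_eq_nonhomWS (M : GL (Fin d) ℝ) (φ : Fin r → L2 d) (ψ : Fin s → L2 d) {J : ℤ}
    (p : Fin s × ℤ × (Fin d → ℤ)) (hp : J ≤ p.2.1) :
    homWS M ψ p = nonhomWS M φ ψ J (Sum.inr (p.1, ⟨p.2.1, hp⟩, p.2.2)) := rfl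

theorem spanDense_homWS (hd : 0 < d) (hM : IsExpansive M)
    (h : IsBiorthogonalPair (nonhomWS M φ ψ 0) (nonhomWS M φ' ψ' 0)) :
    SpanDense (homWS M ψ) := by
  rw [SpanDense, Submodule.dense_iff_topologicalClosure_eq_top,
    Submodule.topologicalClosure_eq_top_iff, Submodule.eq_bot_iff]
  intro f hf
  exact eq_zero_of_forall_inner_homWS_eq_zero hd hM h fun p =>
    (Submodule.mem_orthogonal _ _).1 hf _ (Submodule.subset_span ⟨p, rfl⟩)

/-- The Riesz bounds of the nonhomogeneous system of level `0` hold for the homogeneous system: a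
finite part of the latter is a dilate of a part of the former. -/
theorem isRieszBasis_homWS (hd : 0 < d) (hM : IsExpansive M)
    (h : IsBiorthogonalPair (nonhomWS M φ ψ 0) (nonhomWS M φ' ψ' 0)) :
    IsRieszBasis (homWS M ψ) := by
  classical
  obtain ⟨C₁, C₂, h₁, h₂, hb⟩ := h.1.exists_bounds
  refine ⟨spanDense_homWS hd hM h, C₁, C₂, h₁, h₂, fun c => ?_⟩
  obtain ⟨n, hn⟩ : ∃ n : ℕ, ∀ p ∈ c.support, -(n : ℤ) ≤ p.2.1 := by
    refine ⟨∑ p ∈ c.support, p.2.1.natAbs, fun p hp => ?_⟩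
    have := Finset.single_le_sum (f := fun p : Fin s × ℤ × (Fin d → ℤ) => p.2.1.natAbs)
      (fun _ _ => Nat.zero_le _) hp
    omega
  -- dilating by `M ^ n` raises all levels in the support of `c` to at least `0`
  let σ : c.support → NWIndex d r s 0 := fun p =>
    Sum.inr (p.1.1, ⟨p.1.2.1 + n, by have := hn p.1 p.2; omega⟩, p.1.2.2)
  have hσ : Function.Injective σ := by
    rintro ⟨⟨p, j, k⟩, hp⟩ ⟨⟨p', j', k'⟩, hp'⟩ hpp
    simp only [σ, Sum.inr.injEq, Prod.mk.injEq, Subtype.mk.injEq] at hpp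
    obtain ⟨rfl, hj, rfl⟩ := hpp
    have : j = j' := by omega
    subst this
    rfl
  have hσe : ∀ p : c.support, nonhomWS M φ ψ 0 (σ p) = dilₗᵢ (M ^ n) (homWS M ψ p) := by
    rintro ⟨⟨p, j, k⟩, hp⟩
    simp only [σ, nonhomWS, homWS, Sum.elim_inr, dilₗᵢ_apply]
    rw [dil_dil _ _ _ _ k (by simp), ← zpow_natCast, ← _root_.zpow_add]
  let a : NWIndex d r s 0 → ℂ := Function.extend σ (fun p => c p) 0
  have ha : ∀ p, a (σ p) = c p := fun p => hσ.extend_apply _ _ _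
  have hmain := hb (Finset.univ.map ⟨σ, hσ⟩) a
  simp only [Finset.sum_map, Function.Embedding.coeFn_mk, ha, hσe, ← map_smul, ← map_sum,
    LinearIsometryEquiv.norm_map] at hmain
  rwa [Finset.univ_eq_attach, Finset.sum_attach c.support fun p => ‖c p‖ ^ 2,
    Finset.sum_attach c.support fun p => c p • homWS M ψ p] at hmain

theorem isBiorthogonalPair_homWS (hd : 0 < d) (hM : IsExpansive M)
    (h : IsBiorthogonalPair (nonhomWS M φ ψ 0) (nonhomWS M φ' ψ' 0)) :
    IsBiorthogonalPair (homWS M ψ) (homWS M ψ') := by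
  classical
  refine ⟨isRieszBasis_homWS hd hM h, isRieszBasis_homWS hd hM h.symm, fun p p' => ?_⟩
  let J := min p.2.1 p'.2.1
  have hJ := isBiorthogonalPair_nonhomWS_of_level h J
  rw [homWS_eq_nonhomWS M φ ψ p (min_le_left _ _ : J ≤ _),
    homWS_eq_nonhomWS M φ' ψ' p' (min_le_right _ _ : J ≤ _), hJ.2.2]
  congr 1
  simp only [Sum.inr.injEq, Prod.ext_iff, Subtype.ext_iff]

/-- The refinement equations, with the coefficients of the generators with respect to the
first-level translates of the `φ`'s. -/
theorem refines_mask {m : ℕ} (h : IsBiorthogonalPair (nonhomWS M φ ψ 0) (nonhomWS M φ' ψ' 0))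
    (ι : Fin m → Fin r ⊕ Fin s) (k : Fin d → ℤ) :
    Refines M k
      (fun ξ => Matrix.of fun i l => mask M φ' (dil 1 k (Sum.elim φ ψ (ι i))) l ξ)
      (fun i => Sum.elim φ ψ (ι i)) φ := by
  filter_upwards [ae_all_iff.2 fun i => hat_act_transpose_eq_sum_mask h (ι i) k] with ξ hξ
  ext i
  rw [Pi.smul_apply, smul_eq_mul, hξ i]
  rfl

theorem natCast_card_generators {N : Matrix (Fin d) (Fin d) ℤ}
    (h : IsBiorthogonalPair (nonhomWS M φ ψ 0) (nonhomWS M φ' ψ' 0))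
    (hM : (M : Matrix (Fin d) (Fin d) ℝ) = N.map (Int.cast : ℤ → ℝ)) :
    N.det ≠ 0 ∧ (s : ℤ) = r * (|N.det| - 1) := by
  have hN : N.det ≠ 0 := by
    have := det_ne_zero M
    rw [hM, det_map_intCast] at this
    exact_mod_cast this
  have h1 : (r : ℤ) + s = r * |N.det| := by
    rw [Int.abs_eq_natAbs]
    exact_mod_cast card_generators h hM hN
  refine ⟨hN, ?_⟩
  linear_combination h1

theorem exists_masks (h : IsBiorthogonalPair (nonhomWS M φ ψ 0) (nonhomWS M φ' ψ' 0)) :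
    ∃ (a a' : (Fin d → ℤ) → E d → Matrix (Fin r) (Fin r) ℂ)
      (b b' : (Fin d → ℤ) → E d → Matrix (Fin s) (Fin r) ℂ),
      (∀ k, IsPeriodicL2Matrix (a k) ∧ IsPeriodicL2Matrix (a' k) ∧
        IsPeriodicL2Matrix (b k) ∧ IsPeriodicL2Matrix (b' k)) ∧
      (∀ k, Refines M k (a k) φ φ ∧ Refines M k (b k) ψ φ ∧
        Refines M k (a' k) φ' φ' ∧ Refines M k (b' k) ψ' φ') ∧
      (∀ N : Matrix (Fin d) (Fin d) ℤ,
        (M : Matrix (Fin d) (Fin d) ℝ) = N.map (Int.cast : ℤ → ℝ) →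
        (s : ℤ) = r * (|N.det| - 1) ∧
        (Nat.card (freqShifts M) : ℤ) = |N.det| ∧
        IsDualFilterBank M (a' 0) (b' 0) (a 0) (b 0)) := by
  refine ⟨fun k ξ => Matrix.of fun i l => mask M φ' (dil 1 k (φ i)) l ξ,
    fun k ξ => Matrix.of fun i l => mask M φ (dil 1 k (φ' i)) l ξ,
    fun k ξ => Matrix.of fun i l => mask M φ' (dil 1 k (ψ i)) l ξ,
    fun k ξ => Matrix.of fun i l => mask M φ (dil 1 k (ψ' i)) l ξ, fun k => ?_, fun k => ?_,
    fun N hM => ?_⟩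
  · exact ⟨fun i l => isPeriodicL2_mask M φ' _ l, fun i l => isPeriodicL2_mask M φ _ l,
      fun i l => isPeriodicL2_mask M φ' _ l, fun i l => isPeriodicL2_mask M φ _ l⟩
  · exact ⟨refines_mask h Sum.inl k, refines_mask h Sum.inr k,
      refines_mask h.symm Sum.inl k, refines_mask h.symm Sum.inr k⟩
  · obtain ⟨hN, hs⟩ := natCast_card_generators h hM
    refine ⟨hs, by rw [card_freqShifts hM hN, Int.abs_eq_natAbs], ?_⟩
    simpa only [dil_one_zero] using isDualFilterBank_mask h hM hN

end

end WaveletSystems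

end

theorem mainTheorem2 {d : ℕ} (hd : 0 < d) (M : GL (Fin d) ℝ) {r s : ℕ} :
    (∀ (φ φ' : Fin r → WaveletSystems.L2 d) (ψ ψ' : Fin s → WaveletSystems.L2 d),
      (∃ J : ℤ, WaveletSystems.IsBiorthogonalPair
        (WaveletSystems.nonhomWS M φ ψ J) (WaveletSystems.nonhomWS M φ' ψ' J)) →
      (∀ J : ℤ, WaveletSystems.IsBiorthogonalPair
        (WaveletSystems.nonhomWS M φ ψ J) (WaveletSystems.nonhomWS M φ' ψ' J)) ∧
      (∃ (a a' : (Fin d → ℤ) → WaveletSystems.E d → Matrix (Fin r) (Fin r) ℂ)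
          (b b' : (Fin d → ℤ) → WaveletSystems.E d → Matrix (Fin s) (Fin r) ℂ),
        (∀ k, WaveletSystems.IsPeriodicL2Matrix (a k) ∧ WaveletSystems.IsPeriodicL2Matrix (a' k) ∧
          WaveletSystems.IsPeriodicL2Matrix (b k) ∧ WaveletSystems.IsPeriodicL2Matrix (b' k)) ∧
        (∀ k, WaveletSystems.Refines M k (a k) φ φ ∧ WaveletSystems.Refines M k (b k) ψ φ ∧
          WaveletSystems.Refines M k (a' k) φ' φ' ∧ WaveletSystems.Refines M k (b' k) ψ' φ') ∧
        (∀ N : Matrix (Fin d) (Fin d) ℤ,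
          (M : Matrix (Fin d) (Fin d) ℝ) = N.map (Int.cast : ℤ → ℝ) →
          (s : ℤ) = r * (|N.det| - 1) ∧
          (Nat.card (WaveletSystems.freqShifts M) : ℤ) = |N.det| ∧
          WaveletSystems.IsDualFilterBank M (a' 0) (b' 0) (a 0) (b 0))) ∧
      (WaveletSystems.IsExpansive M →
        WaveletSystems.IsBiorthogonalPair
          (WaveletSystems.homWS M ψ) (WaveletSystems.homWS M ψ'))) ∧
    (∀ (φ : Fin r → WaveletSystems.L2 d) (ψ : Fin s → WaveletSystems.L2 d),
      (∃ J : ℤ, WaveletSystems.IsONB (WaveletSystems.nonhomWS M φ ψ J)) →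
      (∀ N : Matrix (Fin d) (Fin d) ℤ,
        (M : Matrix (Fin d) (Fin d) ℝ) = N.map (Int.cast : ℤ → ℝ) →
        (s : ℤ) = r * (|N.det| - 1)) ∧
      (∃ (a : WaveletSystems.E d → Matrix (Fin r) (Fin r) ℂ)
          (b : WaveletSystems.E d → Matrix (Fin s) (Fin r) ℂ),
        WaveletSystems.IsPeriodicL2Matrix a ∧ WaveletSystems.IsPeriodicL2Matrix b ∧
        WaveletSystems.Refines M 0 a φ φ ∧ WaveletSystems.Refines M 0 b ψ φ) ∧
      (WaveletSystems.IsExpansive M →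
        WaveletSystems.IsONB (WaveletSystems.homWS M ψ))) := by
  refine ⟨fun φ φ' ψ ψ' ⟨J, hJ⟩ => ?_, fun φ ψ ⟨J, hJ⟩ => ?_⟩
  · have h := WaveletSystems.isBiorthogonalPair_nonhomWS_of_level hJ 0
    exact ⟨WaveletSystems.isBiorthogonalPair_nonhomWS_of_level hJ, WaveletSystems.exists_masks h,
      fun hM => WaveletSystems.isBiorthogonalPair_homWS hd hM h⟩
  · -- an orthonormal basis is a pair of biorthogonal bases with itself
    have h := WaveletSystems.isBiorthogonalPair_nonhomWS_of_level hJ.isBiorthogonalPair 0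
    obtain ⟨a, a', b, b', hper, href, hN⟩ := WaveletSystems.exists_masks h
    exact ⟨fun N hM => (hN N hM).1,
      ⟨a 0, b 0, (hper 0).1, (hper 0).2.2.1, (href 0).1, (href 0).2.1⟩,
      fun hM => (WaveletSystems.isBiorthogonalPair_homWS hd hM h).isONB⟩
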